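/- Consider the linear model $\mathbf y=\mathbf X\boldsymbol\beta+\boldsymbol\epsilon$, $\boldsymbol\epsilon\sim N(\mathbf 0,\sigma^2\boldsymbol\Sigma)$, where $\mathbf X$ is a known $n\times K$ matrix of full column rank, $K=r_1+r_2<n$, $r_1\ge 1$, $r_2\ge 0$, $\boldsymbol\Sigma$ is a known positive definite matrix, and $\sigma^2>0$ is unknown. Let $\mathbf R$ be an $r_1\times K$ matrix of full row rank, let $\mathbf D$ consist of $r_2$ linearly independent rows of $(\mathbf I-\mathbf R'(\mathbf R\mathbf R')^{-1}\mathbf R)\mathbf X'\boldsymbol\Sigma^{-1}\mathbf X$, and put $\boldsymbol\theta=\mathbf R\boldsymbol\beta$, $\boldsymbol\gamma=\mathbf D\boldsymbol\beta$, $\mathbf T=\begin{bmatrix}\mathbf R\\ \mathbf D\end{bmatrix}$, $[\mathbf X_\theta\ \mathbf X_\gamma]=\mathbf X\mathbf T^{-1}$, so that $\mathbf y=\mathbf X_\theta\boldsymbol\theta+\mathbf X_\gamma\boldsymbol\gamma+\boldsymbol\epsilon$. Write $\mathbf A=\mathbf X_\theta'\boldsymbol\Sigma^{-1}\mathbf X_\theta$,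 $\hat{\boldsymbol\theta}=\mathbf A^{-1}\mathbf X_\theta'\boldsymbol\Sigma^{-1}\mathbf y$, $\hat{\boldsymbol\gamma}=(\mathbf X_\gamma'\boldsymbol\Sigma^{-1}\mathbf X_\gamma)^{-1}\mathbf X_\gamma'\boldsymbol\Sigma^{-1}\mathbf y$ and $s_{\mathbf y}^2=\mathbf e'\boldsymbol\Sigma^{-1}\mathbf e$ with $\mathbf e=\mathbf y-\mathbf X_\theta\hat{\boldsymbol\theta}-\mathbf X_\gamma\hat{\boldsymbol\gamma}$. Let $\boldsymbol\Omega$ be a positive definite $r_1\times r_1$ matrix, $s^2>0$ and $\nu\ge 0$. The encompassing conjugate prior is $\pi(\boldsymbol\theta,\boldsymbol\gamma,\sigma^2)\propto N_{\boldsymbol\theta\mid\sigma^2}(\mathbf 0,\sigma^2\boldsymbol\Omega)\times 1\times (\sigma^2)^{-\nu/2-1}e^{-\nu s^2/(2\sigma^2)}$, and $P_\pi(\,\cdot\mid\mathbf y)$ is the resulting posterior. Under $H_0:\boldsymbol\theta\le\mathbf 0$ (coordinatewise) and $H_1:\boldsymbol\theta\not\le\mathbf 0$ the prior of $\boldsymbol\theta$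 given $\sigma^2$ is $N(\mathbf 0,\sigma^2\boldsymbol\Omega)$ truncated to the hypothesis and renormalised, with the same priors on $\boldsymbol\gamma$ and $\sigma^2$; $B_{10}(\mathbf y)$ is the ratio of the marginal likelihood of $H_1$ to that of $H_0$. For a fixed value $S\ge 0$ of $s_{\mathbf y}^2$, $B_{10}$ is called information consistent if, along all sequences of data with $s_{\mathbf y}^2=S$, $B_{10}\to\infty$ whenever $|\hat{\boldsymbol\theta}|\to\infty$ with at least one coordinate of $\hat{\boldsymbol\theta}$ going to $\infty$, and $B_{10}\to 0$ whenever all coordinates of $\hat{\boldsymbol\theta}$ go to $-\infty$; otherwise it is information inconsistent. Then: 1. There is $\varepsilon>0$, not depending on $\mathbf y$, with $\varepsilon\le P_\pi(\boldsymbol\theta\le\mathbf 0\mid\mathbf y)\le 1-\varepsilon$ for all $\mathbf y\in\mathbb R^n$ (if $\nu=0$: for all $\mathbf y$ outside the column space of $\mathbf X_\gamma$, where the posterior is proper). 2. $B_{10}$ is information inconsistent, for every $S\ge 0$. 3. Let $\mathbf v\in\mathbb R^{r_1}\setminus\{\mathbf 0\}$ and let the data $\mathbf y=\mathbf y_c$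 satisfy $\hat{\boldsymbol\theta}=c\,\mathbf v$ for all large $c$ and $s_{\mathbf y}^2=o(c^2)$ as $c\to\infty$ (for instance, $s_{\mathbf y}^2$ fixed). Then, as $c\to\infty$, $P_\pi(\boldsymbol\theta\le\mathbf 0\mid\mathbf y_c)\to P(\boldsymbol\xi\le\mathbf 0)$, where $\boldsymbol\xi$ has the multivariate $t$ distribution with location $$\mathbf v^*=\frac{(\mathbf A+\boldsymbol\Omega^{-1})^{-1}\mathbf A\,\mathbf v}{(n+\nu-r_2)^{-1/2}\left(\mathbf v'(\mathbf A^{-1}+\boldsymbol\Omega)^{-1}\mathbf v\right)^{1/2}},$$ scale matrix $(\mathbf A+\boldsymbol\Omega^{-1})^{-1}$ and $n+\nu-r_2$ degrees of freedom. -/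

import Mathlib

open Filter Topology MeasureTheory
open scoped ENNReal Matrix

noncomputable section

/-- Density at `x` of the multivariate normal distribution `N(μ, V)` on `ℝᵏ`. -/
def mvNormalPDF {k : ℕ} (μ : Fin k → ℝ) (V : Matrix (Fin k) (Fin k) ℝ) (x : Fin k → ℝ) : ℝ :=
  (√((2 * Real.pi) ^ k * V.det))⁻¹ * Real.exp (-((x - μ) ⬝ᵥ (V⁻¹ *ᵥ (x - μ))) / 2)

/-- Density at `x` of the multivariate Student t distribution on `ℝᵏ` with location `μ`,
scale matrix `V` and `d` degrees of freedom. -/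
def mvStudentPDF {k : ℕ} (μ : Fin k → ℝ) (V : Matrix (Fin k) (Fin k) ℝ) (d : ℝ)
    (x : Fin k → ℝ) : ℝ :=
  Real.Gamma ((d + k) / 2) / (Real.Gamma (d / 2) * √((d * Real.pi) ^ k * V.det)) *
    (1 + ((x - μ) ⬝ᵥ (V⁻¹ *ᵥ (x - μ))) / d) ^ (-((d + k) / 2))

/-- The multivariate Student t distribution. -/
def mvStudent {k : ℕ} (μ : Fin k → ℝ) (V : Matrix (Fin k) (Fin k) ℝ) (d : ℝ) :
    Measure (Fin k → ℝ) :=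
  volume.withDensity fun x => ENNReal.ofReal (mvStudentPDF μ V d x)

/-- Kernel of the scaled inverse chi-squared density with scale `s2` and `ν` degrees of freedom,
at `w > 0`. For `ν = 0` it is the improper prior `1 / w`. -/
def invChiSqKernel (s2 ν w : ℝ) : ℝ :=
  w ^ (-(ν / 2 + 1)) * Real.exp (-(ν * s2) / (2 * w))

/-- The data of a one-sided test of `Rβ ≤ 0` in the linear model `y = Xβ + ε`,
`ε ∼ N(0, σ² Sig)`, with `n` observations, `r₁` tested linear combinations and `r₂` nuisance
parameters; `row` selects the rows that make up the nuisance matrix (see `nuisance`), and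
`Omega`, `s2`, `nu` are the hyperparameters of the conjugate prior. -/
structure OneSidedTest (n r₁ r₂ : ℕ) where
  X : Matrix (Fin n) (Fin (r₁ + r₂)) ℝ
  Sig : Matrix (Fin n) (Fin n) ℝ
  R : Matrix (Fin r₁) (Fin (r₁ + r₂)) ℝ
  row : Fin r₂ → Fin (r₁ + r₂)
  Omega : Matrix (Fin r₁) (Fin r₁) ℝ
  s2 : ℝ
  nu : ℝ

namespace OneSidedTest

variable {n r₁ r₂ : ℕ} (M : OneSidedTest n r₁ r₂)

/-- The orthogonal projection `I - R'(RR')⁻¹R`. -/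
def projPerp : Matrix (Fin (r₁ + r₂)) (Fin (r₁ + r₂)) ℝ :=
  1 - M.Rᵀ * (M.R * M.Rᵀ)⁻¹ * M.R

/-- The matrix `D` of the nuisance parameter `γ = Dβ`: the selected rows of
`(I - R'(RR')⁻¹R) X' Sig⁻¹ X`. -/
def nuisance : Matrix (Fin r₂) (Fin (r₁ + r₂)) ℝ :=
  (M.projPerp * (M.Xᵀ * M.Sig⁻¹ * M.X)).submatrix M.row id

/-- The matrix `T` with the rows of `R` on top of those of `D`. -/
def T : Matrix (Fin (r₁ + r₂)) (Fin (r₁ + r₂)) ℝ :=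
  Matrix.of (Fin.append M.R M.nuisance)

/-- The first `r₁` columns of `X T⁻¹`. -/
def Xθ : Matrix (Fin n) (Fin r₁) ℝ := (M.X * M.T⁻¹).submatrix id (Fin.castAdd r₂)

/-- The last `r₂` columns of `X T⁻¹`. -/
def Xγ : Matrix (Fin n) (Fin r₂) ℝ := (M.X * M.T⁻¹).submatrix id (Fin.natAdd r₁)

/-- `Xθ' Sig⁻¹ Xθ`. -/
def infoθ : Matrix (Fin r₁) (Fin r₁) ℝ := M.Xθᵀ * M.Sig⁻¹ * M.Xθ

/-- The ML estimate of `θ`. -/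
def θhat (y : Fin n → ℝ) : Fin r₁ → ℝ := M.infoθ⁻¹ *ᵥ (M.Xθᵀ *ᵥ (M.Sig⁻¹ *ᵥ y))

/-- The ML estimate of `γ`. -/
def γhat (y : Fin n → ℝ) : Fin r₂ → ℝ :=
  (M.Xγᵀ * M.Sig⁻¹ * M.Xγ)⁻¹ *ᵥ (M.Xγᵀ *ᵥ (M.Sig⁻¹ *ᵥ y))

/-- The residual vector `y - Xθ θhat - Xγ γhat`. -/
def resid (y : Fin n → ℝ) : Fin n → ℝ := y - M.Xθ *ᵥ M.θhat y - M.Xγ *ᵥ M.γhat y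

/-- The sum of squares `s_y²`. -/
def sy2 (y : Fin n → ℝ) : ℝ := M.resid y ⬝ᵥ (M.Sig⁻¹ *ᵥ M.resid y)

/-- Likelihood of `(θ, γ, σ² = w)` for the data `y`. -/
def likelihood (y : Fin n → ℝ) (θ : Fin r₁ → ℝ) (γ : Fin r₂ → ℝ) (w : ℝ) : ℝ :=
  mvNormalPDF (M.Xθ *ᵥ θ + M.Xγ *ᵥ γ) (w • M.Sig) y

/-- The conditional encompassing prior density of `θ` given `σ² = w`. -/
def priorθ (w : ℝ) (θ : Fin r₁ → ℝ) : ℝ := mvNormalPDF 0 (w • M.Omega) θ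

/-- The unnormalised posterior mass of `{θ ∈ A}` under the encompassing prior
`π(θ, γ, σ²) ∝ N(θ; 0, σ² Omega) × 1 × inv-χ²(σ²; s2, nu)`. -/
def posteriorMass (y : Fin n → ℝ) (A : Set (Fin r₁ → ℝ)) : ℝ≥0∞ :=
  ∫⁻ θ in A, ∫⁻ γ : Fin r₂ → ℝ, ∫⁻ w in Set.Ioi (0 : ℝ),
    ENNReal.ofReal (M.likelihood y θ γ w * (M.priorθ w θ * invChiSqKernel M.s2 M.nu w))

/-- The posterior probability of `{θ ∈ A}` given `y` under the encompassing prior. -/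
def posteriorProb (y : Fin n → ℝ) (A : Set (Fin r₁ → ℝ)) : ℝ :=
  (M.posteriorMass y A / M.posteriorMass y Set.univ).toReal

/-- The prior probability of `{θ ∈ A}` given `σ² = w` under the encompassing prior. -/
def priorProb (w : ℝ) (A : Set (Fin r₁ → ℝ)) : ℝ≥0∞ :=
  ∫⁻ θ in A, ENNReal.ofReal (M.priorθ w θ)

/-- The encompassing prior density of `θ` given `σ² = w`, truncated to `A` and renormalised. -/
def truncPriorθ (A : Set (Fin r₁ → ℝ)) (w : ℝ) (θ : Fin r₁ → ℝ) : ℝ≥0∞ :=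
  A.indicator (fun θ => ENNReal.ofReal (M.priorθ w θ) / M.priorProb w A) θ

/-- The marginal likelihood of the hypothesis `θ ∈ A` under the truncated prior. -/
def marginal (A : Set (Fin r₁ → ℝ)) (y : Fin n → ℝ) : ℝ≥0∞ :=
  ∫⁻ θ : Fin r₁ → ℝ, ∫⁻ γ : Fin r₂ → ℝ, ∫⁻ w in Set.Ioi (0 : ℝ),
    ENNReal.ofReal (M.likelihood y θ γ w) * M.truncPriorθ A w θ *
      ENNReal.ofReal (invChiSqKernel M.s2 M.nu w)

/-- The Bayes factor of `H₁ : θ ≰ 0` against `H₀ : θ ≤ 0`. -/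
def B10 (y : Fin n → ℝ) : ℝ≥0∞ := M.marginal (Set.Iic 0)ᶜ y / M.marginal (Set.Iic 0) y

/-- Information consistency of a one-sided Bayes factor `B`, a function of the data, when the
sum of squares `s_y²` is held fixed at `S`: along all sequences of such data, `B → ∞` if
`|θhat| → ∞` with some coordinate of `θhat` going to `∞`, and `B → 0` if all coordinates of
`θhat` go to `-∞`. -/
def InformationConsistent (B : (Fin n → ℝ) → ℝ≥0∞) (S : ℝ) : Prop :=
  (∀ y : ℕ → Fin n → ℝ, (∀ i, M.sy2 (y i) = S) →
    Tendsto (fun i => ‖WithLp.toLp 2 (M.θhat (y i))‖) atTop atTop →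
    (∃ j, Tendsto (fun i => M.θhat (y i) j) atTop atTop) →
    Tendsto (fun i => B (y i)) atTop (𝓝 ∞)) ∧
  (∀ y : ℕ → Fin n → ℝ, (∀ i, M.sy2 (y i) = S) →
    (∀ j, Tendsto (fun i => M.θhat (y i) j) atTop atBot) →
    Tendsto (fun i => B (y i)) atTop (𝓝 0))

/-- The matrix `(Xθ' Sig⁻¹ Xθ + Omega⁻¹)⁻¹`. -/
def limitScale : Matrix (Fin r₁) (Fin r₁) ℝ := (M.infoθ + M.Omega⁻¹)⁻¹

/-- The degrees of freedom `n + nu - r₂`. -/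
def dof : ℝ := (n : ℝ) + M.nu - r₂

/-- The location `v*` of the limiting distribution along the ray in direction `v`. -/
def limitLoc (v : Fin r₁ → ℝ) : Fin r₁ → ℝ :=
  (M.dof ^ (-(1 / 2) : ℝ) * (v ⬝ᵥ ((M.infoθ⁻¹ + M.Omega)⁻¹ *ᵥ v)) ^ (1 / 2 : ℝ))⁻¹ •
    (M.limitScale *ᵥ (M.infoθ *ᵥ v))

end OneSidedTest

end

/-! ### Integrals over `ℝᵏ` -/

/-! Write A for `infoθ`, Ω for `Omega`, V = (A + Ω⁻¹)⁻¹ for `limitScale` and d = n + ν - r₂ for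
`dof`. The rows of `nuisance` are chosen so that the designs of θ and γ are orthogonal for Σ⁻¹; the
weighted residual sum of squares then splits into s_y², a quadratic form in θ - θhat and one in γ -
γhat. Integrating out γ (Gaussian) and σ² (inverse gamma), and completing the square in θ, leaves a
multiple of (κ + (θ - m)'V⁻¹(θ - m))^(-(d + r₁)/2), where m = V A θhat and κ = s_y² + νs² +
θhat'(A⁻¹ + Ω)⁻¹θhat is `postScale`.

The orthant is a cone, so θ may be rescaled by √(κ/d) without changing it. Hence the posterior
probability of the orthant is that of a t distribution with fixed scale V and fixed d; the data
enter only through its location m/√(κ/d), which is `postLoc`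
(`exists_setLIntegral_cone_eq_mvStudent`, `posteriorProb_eq`).

Both m and √κ grow linearly in θhat, since κ dominates a positive definite form in θhat. The
location therefore stays bounded over all data (`quadForm_postLoc_le`). A bounded shift changes the
t density by a bounded factor (`mvStudentPDF_le_mul`), so the orthant and its complement keep mass
bounded away from 0, which is the first claim. The normalising constants of the truncated priors do
not depend on σ², again because the orthant is a cone; the Bayes factor is thus a constant times the
posterior odds and cannot tend to 0 (`exists_le_B10`). Along a ray the location converges to
`limitLoc` (`tendsto_postLoc`), and t probabilities are continuous in the location
(`continuous_mvStudent_real`). -/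

theorem lintegral_comp_mulVec {k : ℕ} {S : Matrix (Fin k) (Fin k) ℝ} (hS : S.det ≠ 0)
    {f : (Fin k → ℝ) → ℝ≥0∞} (hf : Measurable f) :
    ∫⁻ x, f (S *ᵥ x) = ENNReal.ofReal |S.det⁻¹| * ∫⁻ x, f x := by
  have hmeas : Measurable fun x : Fin k → ℝ => S *ᵥ x :=
    (Continuous.matrix_mulVec continuous_const continuous_id).measurable
  have h := Real.map_matrix_volume_pi_eq_smul_volume_pi hS
  have h' : Measure.map (fun x : Fin k → ℝ => S *ᵥ x) volume
      = ENNReal.ofReal |S.det⁻¹| • volume := by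
    rw [← h]; congr 1
  rw [← lintegral_map hf hmeas, h', lintegral_smul_measure, smul_eq_mul]

/-- Change of scale in an integral over a cone. -/
theorem setLIntegral_cone_comp_smul {k : ℕ} {A : Set (Fin k → ℝ)} (hA : MeasurableSet A)
    {r : ℝ} (hr : 0 < r) (hcone : ∀ x, r • x ∈ A ↔ x ∈ A)
    {f : (Fin k → ℝ) → ℝ≥0∞} (hf : Measurable f) :
    ∫⁻ x in A, f x = ENNReal.ofReal (r ^ k) * ∫⁻ x in A, f (r • x) := by
  have hdet : (r • (1 : Matrix (Fin k) (Fin k) ℝ)).det = r ^ k := by simp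
  have hrk : 0 < r ^ k := pow_pos hr k
  have h := lintegral_comp_mulVec (S := r • (1 : Matrix (Fin k) (Fin k) ℝ))
    (by rw [hdet]; exact hrk.ne') (hf.indicator hA)
  rw [hdet, abs_of_pos (inv_pos.2 hrk)] at h
  rw [← lintegral_indicator hA, ← lintegral_indicator hA]
  have h2 : (fun x => A.indicator f ((r • (1 : Matrix (Fin k) (Fin k) ℝ)) *ᵥ x))
      = A.indicator fun x => f (r • x) := by
    funext x
    rw [Matrix.smul_mulVec, Matrix.one_mulVec]
    by_cases hx : x ∈ A
    · rw [Set.indicator_of_mem hx, Set.indicator_of_mem ((hcone x).2 hx)]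
    · rw [Set.indicator_of_notMem hx, Set.indicator_of_notMem (fun h => hx ((hcone x).1 h))]
  rw [h2] at h
  rw [h, ← mul_assoc, ← ENNReal.ofReal_mul hrk.le, mul_inv_cancel₀ hrk.ne', ENNReal.ofReal_one,
    one_mul]

theorem lintegral_exp_neg_dotProduct_self (k : ℕ) :
    ∫⁻ x : Fin k → ℝ, ENNReal.ofReal (Real.exp (-(x ⬝ᵥ x))) = ENNReal.ofReal (√Real.pi ^ k) := by
  have hprod : ∀ x : Fin k → ℝ, Real.exp (-(x ⬝ᵥ x)) = ∏ i, Real.exp (-1 * x i ^ 2) := by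
    intro x
    rw [← Real.exp_sum, dotProduct, ← Finset.sum_neg_distrib]
    exact congrArg _ (Finset.sum_congr rfl fun i _ => by ring)
  have hint : Integrable fun x : Fin k → ℝ => ∏ i, Real.exp (-1 * x i ^ 2) :=
    Integrable.fintype_prod fun _ => integrable_exp_neg_mul_sq one_pos
  simp_rw [hprod]
  rw [← ofReal_integral_eq_lintegral_ofReal hint
    (ae_of_all _ fun x => Finset.prod_nonneg fun i _ => (Real.exp_pos _).le),
    integral_fintype_prod_volume_eq_pow (fun t : ℝ => Real.exp (-1 * t ^ 2)), integral_gaussian]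
  simp

theorem Matrix.PosDef.exists_transpose_mul_self {k : ℕ} {B : Matrix (Fin k) (Fin k) ℝ}
    (hB : B.PosDef) : ∃ S : Matrix (Fin k) (Fin k) ℝ, B = Sᵀ * S := by
  open scoped MatrixOrder in
  obtain ⟨S, hS⟩ := CStarAlgebra.nonneg_iff_eq_star_mul_self.mp hB.posSemidef.nonneg
  exact ⟨S, by rw [hS, Matrix.star_eq_conjTranspose, Matrix.conjTranspose_eq_transpose_of_trivial]⟩

theorem measurable_quadForm {k : ℕ} (B : Matrix (Fin k) (Fin k) ℝ) (m : Fin k → ℝ) :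
    Measurable fun x : Fin k → ℝ => (x - m) ⬝ᵥ (B *ᵥ (x - m)) := by
  have : Continuous fun x : Fin k → ℝ => (x - m) ⬝ᵥ (B *ᵥ (x - m)) := by fun_prop
  exact this.measurable

/-- The Gaussian integral of a positive definite quadratic form. -/
theorem lintegral_exp_neg_quadForm {k : ℕ} {B : Matrix (Fin k) (Fin k) ℝ} (hB : B.PosDef)
    (m : Fin k → ℝ) {u : ℝ} (hu : 0 < u) :
    ∫⁻ x : Fin k → ℝ, ENNReal.ofReal (Real.exp (-(u * ((x - m) ⬝ᵥ (B *ᵥ (x - m))))))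
      = ENNReal.ofReal (√(Real.pi ^ k / B.det) * u ^ (-(k / 2 : ℝ))) := by
  -- With B = S'S, the linear substitution by √u S reduces everything to the standard Gaussian
  -- integral.
  obtain ⟨S, hS⟩ := hB.exists_transpose_mul_self
  have hdet : B.det = S.det ^ 2 := by rw [hS, Matrix.det_mul, Matrix.det_transpose, sq]
  have hBpos := hB.det_pos
  have hS0 : S.det ≠ 0 := by rintro h; rw [hdet, h] at hBpos; simp at hBpos
  rw [lintegral_sub_right_eq_self
    (fun x => ENNReal.ofReal (Real.exp (-(u * (x ⬝ᵥ (B *ᵥ x)))))) m]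
  have hsu : 0 < √u := Real.sqrt_pos.2 hu
  have hdet' : (√u • S).det = √u ^ k * S.det := by simp
  have hquad : ∀ x : Fin k → ℝ, u * (x ⬝ᵥ (B *ᵥ x)) = ((√u • S) *ᵥ x) ⬝ᵥ ((√u • S) *ᵥ x) := by
    intro x
    rw [Matrix.smul_mulVec, smul_dotProduct, dotProduct_smul, smul_eq_mul, smul_eq_mul, ← mul_assoc,
      Real.mul_self_sqrt hu.le, hS, ← Matrix.mulVec_mulVec, Matrix.dotProduct_mulVec,
      Matrix.vecMul_transpose]
  simp_rw [hquad]
  rw [lintegral_comp_mulVec (S := √u • S)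
    (f := fun x => ENNReal.ofReal (Real.exp (-(x ⬝ᵥ x))))
    (by rw [hdet']; exact mul_ne_zero (pow_ne_zero _ hsu.ne') hS0)
    (by
      have : Continuous fun x : Fin k → ℝ => Real.exp (-(x ⬝ᵥ x)) := by fun_prop
      exact this.measurable.ennreal_ofReal),
    lintegral_exp_neg_dotProduct_self, ← ENNReal.ofReal_mul (abs_nonneg _)]
  congr 1
  have h1 : √(Real.pi ^ k / B.det) = √Real.pi ^ k / |S.det| := by
    rw [Real.sqrt_div (by positivity), hdet, Real.sqrt_sq_eq_abs]
    congr 1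
    rw [Real.sqrt_eq_iff_mul_self_eq (by positivity) (by positivity), ← mul_pow,
      Real.mul_self_sqrt Real.pi_pos.le]
  have h2 : u ^ (-(k / 2 : ℝ)) = (√u ^ k)⁻¹ := by
    rw [Real.rpow_neg hu.le, Real.sqrt_eq_rpow, ← Real.rpow_natCast, ← Real.rpow_mul hu.le]
    congr 2; ring
  rw [h1, h2, hdet', abs_inv, abs_mul, abs_of_pos (pow_pos hsu k)]
  field_simp

theorem lintegral_gamma {a t : ℝ} (ha : 0 < a) (ht : 0 < t) :
    ∫⁻ u in Set.Ioi (0 : ℝ), ENNReal.ofReal (u ^ (a - 1) * Real.exp (-(t * u)))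
      = ENNReal.ofReal (Real.Gamma a * t ^ (-a)) := by
  have hint : IntegrableOn (fun u : ℝ => u ^ (a - 1) * Real.exp (-(t * u))) (Set.Ioi 0) := by
    refine (integrableOn_rpow_mul_exp_neg_mul_rpow (s := a - 1) (p := 1) (b := t) (by linarith)
      one_pos ht).congr_fun (fun x _ => ?_) measurableSet_Ioi
    simp
  rw [← ofReal_integral_eq_lintegral_ofReal hint
    ((ae_restrict_iff' measurableSet_Ioi).2 (ae_of_all _ fun u hu =>
      mul_nonneg (Real.rpow_nonneg (le_of_lt hu) _) (Real.exp_pos _).le)),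
    Real.integral_rpow_mul_exp_neg_mul_Ioi ha ht]
  rw [one_div, Real.inv_rpow ht.le, Real.rpow_neg ht.le, mul_comm]

/-- The normalising constant of the inverse gamma distribution. -/
theorem lintegral_inv_gamma {a t : ℝ} (ha : 0 < a) (ht : 0 < t) :
    ∫⁻ w in Set.Ioi (0 : ℝ), ENNReal.ofReal (w ^ (-(a + 1)) * Real.exp (-(t / w)))
      = ENNReal.ofReal (Real.Gamma a * t ^ (-a)) := by
  set g : ℝ → ℝ := fun u => u ^ (a - 1) * Real.exp (-(t * u)) with hg
  have hint : IntegrableOn g (Set.Ioi 0) := by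
    refine (integrableOn_rpow_mul_exp_neg_mul_rpow (s := a - 1) (p := 1) (b := t) (by linarith)
      one_pos ht).congr_fun (fun x _ => ?_) measurableSet_Ioi
    simp [hg]
  -- The substitution u = w⁻¹ into the gamma integral, in the form |p| w^(p - 1) g(w^p) with p = -1.
  have hpt : ∀ w ∈ Set.Ioi (0 : ℝ), w ^ (-(a + 1)) * Real.exp (-(t / w))
      = (|(-1 : ℝ)| * w ^ ((-1 : ℝ) - 1)) • g (w ^ (-1 : ℝ)) := by
    intro w hw
    have hw' : 0 < w := hw
    simp only [hg, smul_eq_mul, abs_neg, abs_one, one_mul]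
    rw [← mul_assoc, ← Real.rpow_mul hw'.le, ← Real.rpow_add hw', Real.rpow_neg_one, div_eq_mul_inv]
    congr 2; ring
  have hint' : IntegrableOn (fun w : ℝ => w ^ (-(a + 1)) * Real.exp (-(t / w))) (Set.Ioi 0) :=
    ((integrableOn_Ioi_comp_rpow_iff g (p := -1) (by norm_num)).2 hint).congr_fun
      (fun w hw => (hpt w hw).symm) measurableSet_Ioi
  rw [← ofReal_integral_eq_lintegral_ofReal hint'
    ((ae_restrict_iff' measurableSet_Ioi).2 (ae_of_all _ fun u hu =>
      mul_nonneg (Real.rpow_nonneg (le_of_lt hu) _) (Real.exp_pos _).le)),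
    setIntegral_congr_fun measurableSet_Ioi hpt, integral_comp_rpow_Ioi g (by norm_num),
    Real.integral_rpow_mul_exp_neg_mul_Ioi ha ht, one_div, Real.inv_rpow ht.le,
    Real.rpow_neg ht.le, mul_comm]

/-! ### Quadratic forms -/

theorem Matrix.PosDef.quadForm_pos {k : ℕ} {B : Matrix (Fin k) (Fin k) ℝ} (hB : B.PosDef)
    {x : Fin k → ℝ} (hx : x ≠ 0) : 0 < x ⬝ᵥ (B *ᵥ x) := by
  simpa using hB.dotProduct_mulVec_pos hx

theorem Matrix.PosDef.quadForm_nonneg {k : ℕ} {B : Matrix (Fin k) (Fin k) ℝ} (hB : B.PosDef)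
    (x : Fin k → ℝ) : 0 ≤ x ⬝ᵥ (B *ᵥ x) := by
  simpa using hB.posSemidef.dotProduct_mulVec_nonneg x

theorem Matrix.PosDef.transpose_eq {k : ℕ} {B : Matrix (Fin k) (Fin k) ℝ} (hB : B.PosDef) :
    Bᵀ = B := by
  have := hB.isHermitian.eq
  rwa [Matrix.conjTranspose_eq_transpose_of_trivial] at this

theorem dotProduct_mulVec_comm {m n : ℕ} (B : Matrix (Fin m) (Fin n) ℝ) (x : Fin m → ℝ)
    (y : Fin n → ℝ) : x ⬝ᵥ (B *ᵥ y) = y ⬝ᵥ (Bᵀ *ᵥ x) := by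
  rw [Matrix.dotProduct_mulVec, Matrix.mulVec_transpose, dotProduct_comm]

theorem quadForm_smul {k : ℕ} (B : Matrix (Fin k) (Fin k) ℝ) (c : ℝ) (x : Fin k → ℝ) :
    (c • x) ⬝ᵥ (B *ᵥ (c • x)) = c ^ 2 * (x ⬝ᵥ (B *ᵥ x)) := by
  rw [Matrix.mulVec_smul, smul_dotProduct, dotProduct_smul, smul_eq_mul, smul_eq_mul]; ring

theorem quadForm_add {k : ℕ} {B : Matrix (Fin k) (Fin k) ℝ} (hB : Bᵀ = B) (x y : Fin k → ℝ) :
    (x + y) ⬝ᵥ (B *ᵥ (x + y)) = x ⬝ᵥ (B *ᵥ x) + 2 * (x ⬝ᵥ (B *ᵥ y)) + y ⬝ᵥ (B *ᵥ y) := by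
  have := dotProduct_mulVec_comm B y x
  rw [hB] at this
  rw [Matrix.mulVec_add, add_dotProduct, dotProduct_add, dotProduct_add, this]; ring

theorem quadForm_sub {k : ℕ} {B : Matrix (Fin k) (Fin k) ℝ} (hB : Bᵀ = B) (x y : Fin k → ℝ) :
    (x - y) ⬝ᵥ (B *ᵥ (x - y)) = x ⬝ᵥ (B *ᵥ x) - 2 * (x ⬝ᵥ (B *ᵥ y)) + y ⬝ᵥ (B *ᵥ y) := by
  have := dotProduct_mulVec_comm B y x
  rw [hB] at this
  rw [Matrix.mulVec_sub, sub_dotProduct, dotProduct_sub, dotProduct_sub, this]; ring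

/-- The parallelogram law, with the nonnegative form at x - y dropped. -/
theorem Matrix.PosDef.quadForm_add_le {k : ℕ} {B : Matrix (Fin k) (Fin k) ℝ} (hB : B.PosDef)
    (x y : Fin k → ℝ) :
    (x + y) ⬝ᵥ (B *ᵥ (x + y)) ≤ 2 * (x ⬝ᵥ (B *ᵥ x)) + 2 * (y ⬝ᵥ (B *ᵥ y)) := by
  have h1 := quadForm_add hB.transpose_eq x y
  have h2 := quadForm_sub hB.transpose_eq x y
  have h3 := hB.quadForm_nonneg (x - y)
  linarith

/-- A positive definite quadratic form dominates a multiple of any other quadratic form. -/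
theorem Matrix.PosDef.exists_quadForm_le {k : ℕ} {N : Matrix (Fin k) (Fin k) ℝ} (hN : N.PosDef)
    (B : Matrix (Fin k) (Fin k) ℝ) :
    ∃ C : ℝ, 0 ≤ C ∧ ∀ x, x ⬝ᵥ (B *ᵥ x) ≤ C * (x ⬝ᵥ (N *ᵥ x)) := by
  -- The ratio of the two forms is homogeneous of degree 0, so its bound on the compact unit sphere
  -- serves everywhere.
  have hcont : ContinuousOn (fun x : Fin k → ℝ => (x ⬝ᵥ (B *ᵥ x)) / (x ⬝ᵥ (N *ᵥ x)))
      (Metric.sphere 0 1) := by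
    refine ContinuousOn.div (by fun_prop) (by fun_prop) fun x hx => ?_
    refine (hN.quadForm_pos ?_).ne'
    rintro rfl
    simp at hx
  obtain ⟨C, hC⟩ := (isCompact_sphere (0 : Fin k → ℝ) 1).exists_bound_of_continuousOn hcont
  refine ⟨|C|, abs_nonneg _, fun x => ?_⟩
  rcases eq_or_ne x 0 with rfl | hx
  · simp
  have hx' : 0 < ‖x‖ := norm_pos_iff.2 hx
  have hmem : ‖x‖⁻¹ • x ∈ Metric.sphere (0 : Fin k → ℝ) 1 := by
    simp [norm_smul, hx'.ne']
  have h := (le_abs_self _).trans ((hC _ hmem).trans (le_abs_self C))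
  rw [quadForm_smul, quadForm_smul, mul_div_mul_left _ _ (by positivity),
    div_le_iff₀ (hN.quadForm_pos hx)] at h
  exact h

/-! ### The multivariate `t` distribution -/

section Student

variable {k : ℕ} {V : Matrix (Fin k) (Fin k) ℝ} {d : ℝ}

theorem one_le_one_add_quadForm_div (hV : V.PosDef) (hd : 0 < d) (x : Fin k → ℝ) :
    1 ≤ 1 + (x ⬝ᵥ (V⁻¹ *ᵥ x)) / d := by
  have := div_nonneg (hV.inv.quadForm_nonneg x) hd.le
  linarith

theorem mvStudent_const_pos (hV : V.PosDef) (hd : 0 < d) :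
    0 < Real.Gamma ((d + k) / 2) / (Real.Gamma (d / 2) * √((d * Real.pi) ^ k * V.det)) := by
  have h1 : 0 < Real.Gamma ((d + k) / 2) := Real.Gamma_pos_of_pos (by positivity)
  have h2 : 0 < Real.Gamma (d / 2) := Real.Gamma_pos_of_pos (by positivity)
  have h3 := hV.det_pos
  have h4 := Real.pi_pos
  positivity

theorem mvStudentPDF_pos (hV : V.PosDef) (hd : 0 < d) (μ x : Fin k → ℝ) :
    0 < mvStudentPDF μ V d x :=
  mul_pos (mvStudent_const_pos hV hd) (Real.rpow_pos_of_pos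
    (one_pos.trans_le (one_le_one_add_quadForm_div hV hd _)) _)

theorem continuous_mvStudentPDF_uncurry (hV : V.PosDef) (hd : 0 < d) :
    Continuous fun p : (Fin k → ℝ) × (Fin k → ℝ) => mvStudentPDF p.1 V d p.2 := by
  unfold mvStudentPDF
  refine continuous_const.mul (Continuous.rpow_const (by fun_prop) fun p => Or.inl ?_)
  exact (one_pos.trans_le (one_le_one_add_quadForm_div hV hd (p.2 - p.1))).ne'

theorem continuous_mvStudentPDF (hV : V.PosDef) (hd : 0 < d) (μ : Fin k → ℝ) :
    Continuous (mvStudentPDF μ V d) := by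
  have h := (continuous_mvStudentPDF_uncurry hV hd).comp
    (Continuous.prodMk_right (X := Fin k → ℝ) (Y := Fin k → ℝ) μ)
  exact h

/-- The t distribution is a gamma mixture of normals: the negative power in the density is a gamma
integral over u, and after swapping the integrals the one over x is Gaussian. It contributes
u^(-k/2), which leaves a gamma integral of exponent d/2. -/
theorem lintegral_mvStudentPDF (hV : V.PosDef) (hd : 0 < d) (μ : Fin k → ℝ) :
    ∫⁻ x, ENNReal.ofReal (mvStudentPDF μ V d x) = 1 := by
  set a : ℝ := (d + k) / 2 with ha
  have ha0 : 0 < a := by positivity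
  set q : (Fin k → ℝ) → ℝ := fun x => (x - μ) ⬝ᵥ (V⁻¹ *ᵥ (x - μ)) with hq
  have hqm : Measurable q := measurable_quadForm _ _
  have hq0 : ∀ x, 0 < 1 + q x / d := fun x =>
    one_pos.trans_le (one_le_one_add_quadForm_div hV hd (x - μ))
  have hΓa : 0 < Real.Gamma a := Real.Gamma_pos_of_pos ha0
  have hΓd : 0 < Real.Gamma (d / 2) := Real.Gamma_pos_of_pos (by positivity)
  have hdet := hV.det_pos
  have hπ := Real.pi_pos
  set c : ℝ := √((d * Real.pi) ^ k * V.det) with hc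
  have hc0 : 0 < c := by positivity
  have hpdf : ∀ x, ENNReal.ofReal (mvStudentPDF μ V d x) = ENNReal.ofReal (Real.Gamma (d / 2) * c)⁻¹ *
      ∫⁻ u in Set.Ioi (0 : ℝ), ENNReal.ofReal (u ^ (a - 1) * Real.exp (-((1 + q x / d) * u))) := by
    intro x
    rw [lintegral_gamma ha0 (hq0 x), ← ENNReal.ofReal_mul (by positivity)]
    congr 1
    simp only [mvStudentPDF, ← ha, ← hc, hq]
    ring
  simp_rw [hpdf]
  rw [lintegral_const_mul' _ _ ENNReal.ofReal_ne_top, lintegral_lintegral_swap (by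
    have : Measurable fun p : (Fin k → ℝ) × ℝ =>
        p.2 ^ (a - 1) * Real.exp (-((1 + q p.1 / d) * p.2)) := by fun_prop
    exact this.ennreal_ofReal.aemeasurable)]
  have hinner : ∀ u ∈ Set.Ioi (0 : ℝ),
      ∫⁻ x, ENNReal.ofReal (u ^ (a - 1) * Real.exp (-((1 + q x / d) * u)))
        = ENNReal.ofReal c * ENNReal.ofReal (u ^ (d / 2 - 1) * Real.exp (-(1 * u))) := by
    intro u hu
    have hu' : 0 < u := hu
    have h1 : ∀ x, ENNReal.ofReal (u ^ (a - 1) * Real.exp (-((1 + q x / d) * u)))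
        = ENNReal.ofReal (u ^ (a - 1) * Real.exp (-u)) *
          ENNReal.ofReal (Real.exp (-(u / d * q x))) := by
      intro x
      rw [← ENNReal.ofReal_mul (by positivity), mul_assoc, ← Real.exp_add]
      congr 3; ring
    simp_rw [h1]
    rw [lintegral_const_mul' _ _ ENNReal.ofReal_ne_top,
      lintegral_exp_neg_quadForm hV.inv μ (div_pos hu' hd), ← ENNReal.ofReal_mul (by positivity),
      ← ENNReal.ofReal_mul hc0.le]
    congr 1
    have h2 : √(Real.pi ^ k / V⁻¹.det) * (u / d) ^ (-(k / 2 : ℝ)) = c * u ^ (-(k / 2 : ℝ)) := by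
      have h3 : c = √(Real.pi ^ k / V⁻¹.det) * d ^ (k / 2 : ℝ) := by
        rw [hc, Matrix.det_nonsing_inv, Ring.inverse_eq_inv', div_inv_eq_mul, mul_pow,
          mul_assoc, Real.sqrt_mul (by positivity), mul_comm]
        congr 1
        rw [Real.sqrt_eq_rpow, ← Real.rpow_natCast, ← Real.rpow_mul hd.le]
        congr 1; ring
      rw [h3, Real.div_rpow hu'.le hd.le, Real.rpow_neg hd.le, div_inv_eq_mul]; ring
    have h4 : u ^ (a - 1) * u ^ (-(k / 2 : ℝ)) = u ^ (d / 2 - 1) := by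
      rw [← Real.rpow_add hu']; congr 1; rw [ha]; ring
    rw [h2, ← h4, one_mul]; ring
  rw [setLIntegral_congr_fun measurableSet_Ioi hinner, lintegral_const_mul' _ _ ENNReal.ofReal_ne_top,
    lintegral_gamma (by positivity) one_pos, ← ENNReal.ofReal_mul hc0.le,
    ← ENNReal.ofReal_mul (by positivity), Real.one_rpow, ← ENNReal.ofReal_one]
  congr 1
  field_simp

theorem isProbabilityMeasure_mvStudent (hV : V.PosDef) (hd : 0 < d) (μ : Fin k → ℝ) :
    IsProbabilityMeasure (mvStudent μ V d) :=
  ⟨by rw [mvStudent, withDensity_apply _ MeasurableSet.univ, Measure.restrict_univ,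
    lintegral_mvStudentPDF hV hd]⟩

theorem integrable_mvStudentPDF (hV : V.PosDef) (hd : 0 < d) (μ : Fin k → ℝ) :
    Integrable (mvStudentPDF μ V d) := by
  refine ⟨(continuous_mvStudentPDF hV hd μ).aestronglyMeasurable, ?_⟩
  rw [hasFiniteIntegral_iff_ofReal (ae_of_all _ fun x => (mvStudentPDF_pos hV hd μ x).le),
    lintegral_mvStudentPDF hV hd]
  exact ENNReal.one_lt_top

theorem mvStudent_real_eq_integral (hV : V.PosDef) (hd : 0 < d) (μ : Fin k → ℝ)
    {A : Set (Fin k → ℝ)} (hA : MeasurableSet A) :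
    (mvStudent μ V d).real A = ∫ x in A, mvStudentPDF μ V d x := by
  rw [Measure.real, mvStudent, withDensity_apply _ hA, ← ofReal_integral_eq_lintegral_ofReal
    (integrable_mvStudentPDF hV hd μ).integrableOn
    (ae_of_all _ fun x => (mvStudentPDF_pos hV hd μ x).le), ENNReal.toReal_ofReal]
  exact integral_nonneg fun x => (mvStudentPDF_pos hV hd μ x).le

/-- A shift of the location changes the `t` density at most by a bounded factor. -/
theorem mvStudentPDF_le_mul (hV : V.PosDef) (hd : 0 < d) (μ μ' x : Fin k → ℝ) :
    mvStudentPDF μ V d x ≤ (2 + 2 * ((μ' - μ) ⬝ᵥ (V⁻¹ *ᵥ (μ' - μ)) / d)) ^ ((d + k) / 2) *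
      mvStudentPDF μ' V d x := by
  set a : ℝ := (d + k) / 2 with ha
  have ha0 : 0 ≤ a := by positivity
  have hc := mvStudent_const_pos hV hd
  set p := (x - μ) ⬝ᵥ (V⁻¹ *ᵥ (x - μ)) with hp
  set p' := (x - μ') ⬝ᵥ (V⁻¹ *ᵥ (x - μ')) with hp'
  set r := (μ' - μ) ⬝ᵥ (V⁻¹ *ᵥ (μ' - μ)) with hr
  have hp0 : 1 ≤ 1 + p / d := one_le_one_add_quadForm_div hV hd _
  have hp0' : 1 ≤ 1 + p' / d := one_le_one_add_quadForm_div hV hd _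
  have hr0 : 0 ≤ r := hV.inv.quadForm_nonneg _
  have hr0' : 0 ≤ r / d := by positivity
  have hle : p' ≤ 2 * p + 2 * r := by
    have h := hV.inv.quadForm_add_le (x - μ) (-(μ' - μ))
    have e : x - μ + -(μ' - μ) = x - μ' := by abel
    rw [e, Matrix.mulVec_neg, neg_dotProduct, dotProduct_neg, neg_neg] at h
    exact h
  -- The additive bound `hle` is made multiplicative, so that it survives taking powers.
  have hle' : 1 + p' / d ≤ (2 + 2 * (r / d)) * (1 + p / d) := by
    have h1 : p' / d ≤ 2 * (p / d) + 2 * (r / d) := by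
      rw [div_le_iff₀ hd]
      have : (2 * (p / d) + 2 * (r / d)) * d = 2 * p + 2 * r := by field_simp
      rw [this]; exact hle
    have h2 : 0 ≤ r / d * (p / d) := mul_nonneg hr0' (by linarith)
    nlinarith
  simp only [mvStudentPDF, ← ha, ← hp, ← hp']
  have h3 : (1 + p / d) ^ (-a) ≤ (2 + 2 * (r / d)) ^ a * (1 + p' / d) ^ (-a) := by
    rw [Real.rpow_neg (by linarith), Real.rpow_neg (by linarith), ← div_eq_mul_inv,
      le_div_iff₀ (Real.rpow_pos_of_pos (by linarith) _), inv_mul_le_iff₀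
      (Real.rpow_pos_of_pos (by linarith) _), mul_comm, ← Real.mul_rpow (by linarith) (by linarith)]
    exact Real.rpow_le_rpow (by linarith) hle' ha0
  calc _ ≤ _ := mul_le_mul_of_nonneg_left h3 hc.le
    _ = _ := by ring

theorem mvStudent_real_le_mul (hV : V.PosDef) (hd : 0 < d) (μ μ' : Fin k → ℝ)
    {A : Set (Fin k → ℝ)} (hA : MeasurableSet A) :
    (mvStudent μ V d).real A ≤ (2 + 2 * ((μ' - μ) ⬝ᵥ (V⁻¹ *ᵥ (μ' - μ)) / d)) ^ ((d + k) / 2) *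
      (mvStudent μ' V d).real A := by
  rw [mvStudent_real_eq_integral hV hd μ hA, mvStudent_real_eq_integral hV hd μ' hA,
    ← integral_const_mul]
  exact setIntegral_mono (integrable_mvStudentPDF hV hd μ).integrableOn
    ((integrable_mvStudentPDF hV hd μ').integrableOn.const_mul _)
    fun x => mvStudentPDF_le_mul hV hd μ μ' x

/-- Dominated convergence: near μ₀ all the densities lie below a constant multiple of the one
located at μ₀. The factor 4 is 2 + 2 · 1, valid where the shift term is less than 1. -/
theorem continuous_mvStudent_real (hV : V.PosDef) (hd : 0 < d)
    {A : Set (Fin k → ℝ)} (hA : MeasurableSet A) :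
    Continuous fun μ => (mvStudent μ V d).real A := by
  simp_rw [fun μ => mvStudent_real_eq_integral hV hd μ hA]
  rw [continuous_iff_continuousAt]
  intro μ₀
  refine continuousAt_of_dominated
    (bound := fun x => (4 : ℝ) ^ ((d + k) / 2) * mvStudentPDF μ₀ V d x)
    (Eventually.of_forall fun μ => (continuous_mvStudentPDF hV hd μ).aestronglyMeasurable) ?_
    ((integrable_mvStudentPDF hV hd μ₀).integrableOn.const_mul _)
    (ae_of_all _ fun x => ((continuous_mvStudentPDF_uncurry hV hd).comp
      (Continuous.prodMk_left x)).continuousAt)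
  have hcont : Continuous fun μ : Fin k → ℝ => (μ₀ - μ) ⬝ᵥ (V⁻¹ *ᵥ (μ₀ - μ)) / d := by fun_prop
  have hev : ∀ᶠ μ in 𝓝 μ₀, (μ₀ - μ) ⬝ᵥ (V⁻¹ *ᵥ (μ₀ - μ)) / d < 1 :=
    hcont.continuousAt.eventually_lt continuousAt_const (by simp)
  filter_upwards [hev] with μ hμ
  refine ae_of_all _ fun x => ?_
  rw [Real.norm_of_nonneg (mvStudentPDF_pos hV hd μ x).le]
  refine (mvStudentPDF_le_mul hV hd μ μ₀ x).trans (mul_le_mul_of_nonneg_right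
    (Real.rpow_le_rpow ?_ (by linarith) (by positivity)) (mvStudentPDF_pos hV hd μ₀ x).le)
  have := div_nonneg (hV.inv.quadForm_nonneg (μ₀ - μ)) hd.le
  linarith

theorem mvStudent_real_pos (hV : V.PosDef) (hd : 0 < d) (μ : Fin k → ℝ)
    {A U : Set (Fin k → ℝ)} (hU : IsOpen U) (hne : U.Nonempty) (hUA : U ⊆ A) :
    0 < (mvStudent μ V d).real A := by
  have := isProbabilityMeasure_mvStudent hV hd μ
  refine lt_of_lt_of_le ?_ (measureReal_mono hUA)
  rw [mvStudent_real_eq_integral hV hd μ hU.measurableSet]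
  rw [setIntegral_pos_iff_support_of_nonneg_ae
    (ae_of_all _ fun x => (mvStudentPDF_pos hV hd μ x).le)
    (integrable_mvStudentPDF hV hd μ).integrableOn]
  have hs : Function.support (mvStudentPDF μ V d) = Set.univ :=
    Set.eq_univ_of_forall fun x => (mvStudentPDF_pos hV hd μ x).ne'
  rw [hs, Set.univ_inter]
  exact hU.measure_pos _ hne

/-- Over a cone, integrals of powers of a quadratic polynomial are `t` probabilities. -/
theorem exists_setLIntegral_cone_eq_mvStudent (hV : V.PosDef) (hd : 0 < d) {κ : ℝ} (hκ : 0 < κ)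
    (m : Fin k → ℝ) :
    ∃ K : ℝ≥0∞, K ≠ 0 ∧ K ≠ ∞ ∧ ∀ A : Set (Fin k → ℝ), MeasurableSet A →
      (∀ r : ℝ, 0 < r → ∀ x, r • x ∈ A ↔ x ∈ A) →
      ∫⁻ x in A, ENNReal.ofReal ((κ + (x - m) ⬝ᵥ (V⁻¹ *ᵥ (x - m))) ^ (-((d + k) / 2)))
        = K * mvStudent ((√(κ / d))⁻¹ • m) V d A := by
  -- Substituting x ↦ r x turns κ + Q(x - m) into κ (1 + Q(x - r⁻¹m)/d), the t kernel up to a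
  -- constant.
  set r := √(κ / d) with hr
  have hr0 : 0 < r := Real.sqrt_pos.2 (by positivity)
  have hr2 : r ^ 2 = κ / d := Real.sq_sqrt (by positivity)
  have hc := mvStudent_const_pos hV hd
  set c := Real.Gamma ((d + k) / 2) / (Real.Gamma (d / 2) * √((d * Real.pi) ^ k * V.det))
    with hcdef
  set a : ℝ := (d + k) / 2 with ha
  have hκa : 0 < κ ^ (-a) := Real.rpow_pos_of_pos hκ _
  refine ⟨ENNReal.ofReal (r ^ k * (κ ^ (-a) * c⁻¹)), ?_, ENNReal.ofReal_ne_top, fun A hA hcone => ?_⟩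
  · rw [Ne, ENNReal.ofReal_eq_zero, not_le]; positivity
  rw [setLIntegral_cone_comp_smul hA hr0 (hcone r hr0) (by
    have := measurable_quadForm V⁻¹ m
    fun_prop), mvStudent, withDensity_apply _ hA, ENNReal.ofReal_mul (by positivity), mul_assoc]
  congr 1
  rw [← lintegral_const_mul' _ _ ENNReal.ofReal_ne_top]
  refine lintegral_congr fun x => ?_
  rw [← ENNReal.ofReal_mul (by positivity)]
  congr 1
  have hx : r • x - m = r • (x - r⁻¹ • m) := by
    rw [smul_sub, smul_smul, mul_inv_cancel₀ hr0.ne', one_smul]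
  have h1 := one_le_one_add_quadForm_div hV hd (x - r⁻¹ • m)
  rw [hx, quadForm_smul, hr2]
  simp only [mvStudentPDF, ← ha, ← hcdef]
  have h2 : κ + κ / d * ((x - r⁻¹ • m) ⬝ᵥ (V⁻¹ *ᵥ (x - r⁻¹ • m)))
      = κ * (1 + (x - r⁻¹ • m) ⬝ᵥ (V⁻¹ *ᵥ (x - r⁻¹ • m)) / d) := by ring
  rw [h2, Real.mul_rpow hκ.le (by linarith)]
  field_simp

end Student

/-! ### The orthogonal reparametrisation -/

namespace OneSidedTest

variable {n r₁ r₂ : ℕ} {M : OneSidedTest n r₁ r₂}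

/-- The rank and definiteness conditions on the data of a one-sided test. -/
structure IsRegular (M : OneSidedTest n r₁ r₂) : Prop where
  linearIndependent_X : LinearIndependent ℝ M.X.col
  posDef_Sig : M.Sig.PosDef
  linearIndependent_R : LinearIndependent ℝ M.R.row
  linearIndependent_nuisance : LinearIndependent ℝ M.nuisance.row
  posDef_Omega : M.Omega.PosDef

variable (M) in
/-- The information matrix `X' Sig⁻¹ X` of `β`. -/
noncomputable def infoβ : Matrix (Fin (r₁ + r₂)) (Fin (r₁ + r₂)) ℝ := M.Xᵀ * M.Sig⁻¹ * M.X

variable (M) in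
/-- The first `r₁` columns of `T⁻¹`. -/
noncomputable def Uθ : Matrix (Fin (r₁ + r₂)) (Fin r₁) ℝ := M.T⁻¹.submatrix id (Fin.castAdd r₂)

variable (M) in
/-- The last `r₂` columns of `T⁻¹`. -/
noncomputable def Uγ : Matrix (Fin (r₁ + r₂)) (Fin r₂) ℝ := M.T⁻¹.submatrix id (Fin.natAdd r₁)

variable (M) in
/-- `Xγ' Sig⁻¹ Xγ`. -/
noncomputable def infoγ : Matrix (Fin r₂) (Fin r₂) ℝ := M.Xγᵀ * M.Sig⁻¹ * M.Xγ

theorem Xθ_eq : M.Xθ = M.X * M.Uθ := rfl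

theorem Xγ_eq : M.Xγ = M.X * M.Uγ := rfl

theorem T_castAdd (i : Fin r₁) (j : Fin (r₁ + r₂)) : M.T (Fin.castAdd r₂ i) j = M.R i j :=
  congrFun (Fin.append_left M.R M.nuisance i) j

theorem T_natAdd (i : Fin r₂) (j : Fin (r₁ + r₂)) : M.T (Fin.natAdd r₁ i) j = M.nuisance i j :=
  congrFun (Fin.append_right M.R M.nuisance i) j

theorem vecMul_T (x : Fin (r₁ + r₂) → ℝ) :
    x ᵥ* M.T = (fun i => x (Fin.castAdd r₂ i)) ᵥ* M.R + (fun i => x (Fin.natAdd r₁ i)) ᵥ* M.nuisance := by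
  funext j
  simp [Matrix.vecMul, dotProduct, Fin.sum_univ_add, T_castAdd, T_natAdd]

theorem T_mul_eq_zero {m : ℕ} {Y : Matrix (Fin (r₁ + r₂)) (Fin m) ℝ} (h₁ : M.R * Y = 0)
    (h₂ : M.nuisance * Y = 0) : M.T * Y = 0 := by
  ext i j
  refine Fin.addCases (fun i => ?_) (fun i => ?_) i
  · have := congrFun (congrFun h₁ i) j
    simpa [Matrix.mul_apply, T_castAdd, T_natAdd] using this
  · have := congrFun (congrFun h₂ i) j
    simpa [Matrix.mul_apply, T_castAdd, T_natAdd] using this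

namespace IsRegular

variable (h : M.IsRegular)
include h

theorem posDef_infoβ : M.infoβ.PosDef := by
  have := h.posDef_Sig.inv.conjTranspose_mul_mul_same (B := M.X)
    (Matrix.mulVec_injective_iff.2 h.linearIndependent_X)
  rwa [Matrix.conjTranspose_eq_transpose_of_trivial] at this

theorem vecMul_R_injective : Function.Injective M.R.vecMul :=
  Matrix.vecMul_injective_iff.2 h.linearIndependent_R

theorem posDef_R_mul_transpose : (M.R * M.Rᵀ).PosDef := by
  have := Matrix.PosDef.mul_conjTranspose_self M.R h.vecMul_R_injective
  rwa [Matrix.conjTranspose_eq_transpose_of_trivial] at this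

theorem posDef_R_mul_inv_mul_transpose : (M.R * M.infoβ⁻¹ * M.Rᵀ).PosDef := by
  have := h.posDef_infoβ.inv.mul_mul_conjTranspose_same h.vecMul_R_injective
  rwa [Matrix.conjTranspose_eq_transpose_of_trivial] at this

theorem projPerp_mul_transpose_R : M.projPerp * M.Rᵀ = 0 := by
  have hdet : IsUnit (M.R * M.Rᵀ).det := h.posDef_R_mul_transpose.det_pos.ne'.isUnit
  rw [projPerp, Matrix.sub_mul, Matrix.one_mul, Matrix.mul_assoc, Matrix.mul_assoc,
    Matrix.nonsing_inv_mul _ hdet, Matrix.mul_one, sub_self]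

/-- This is the purpose of the choice of D: its rows are rows of P `infoβ`, with P the projection
annihilating R', so `infoβ` cancels and rows of P R' = 0 remain. -/
theorem nuisance_mul_inv_mul_transpose_R : M.nuisance * (M.infoβ⁻¹ * M.Rᵀ) = 0 := by
  have hdet : IsUnit M.infoβ.det := h.posDef_infoβ.det_pos.ne'.isUnit
  have h1 : M.projPerp * M.infoβ * (M.infoβ⁻¹ * M.Rᵀ) = 0 := by
    rw [Matrix.mul_assoc, ← Matrix.mul_assoc M.infoβ, Matrix.mul_nonsing_inv _ hdet, Matrix.one_mul,
      h.projPerp_mul_transpose_R]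
  ext i j
  exact congrFun (congrFun h1 (M.row i)) j

theorem isUnit_det_T : IsUnit M.T.det := by
  rw [← Matrix.isUnit_iff_isUnit_det, ← Matrix.vecMul_injective_iff_isUnit]
  refine (injective_iff_map_eq_zero M.T.vecMulLinear).2 fun x hx => ?_
  have hx' : x ᵥ* M.T = 0 := hx
  rw [vecMul_T] at hx'
  set a := fun i => x (Fin.castAdd r₂ i) with ha
  set b := fun i => x (Fin.natAdd r₁ i) with hb
  have h1 : a ᵥ* (M.R * M.infoβ⁻¹ * M.Rᵀ) = 0 := by
    -- Multiplying by `infoβ⁻¹` R' kills the D part and leaves the R part against a positive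
    -- definite matrix.
    have := congrArg (fun z => z ᵥ* (M.infoβ⁻¹ * M.Rᵀ)) hx'
    simpa [Matrix.add_vecMul, Matrix.vecMul_vecMul, h.nuisance_mul_inv_mul_transpose_R,
      Matrix.mul_assoc] using this
  have ha0 : a = 0 :=
    (Matrix.vecMul_injective_iff_isUnit.2 h.posDef_R_mul_inv_mul_transpose.isUnit)
      (h1.trans (Matrix.zero_vecMul _).symm)
  rw [ha0, Matrix.zero_vecMul, zero_add] at hx'
  have hb0 : b = 0 := (Matrix.vecMul_injective_iff.2 h.linearIndependent_nuisance)
    (hx'.trans (Matrix.zero_vecMul _).symm)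
  funext i
  exact Fin.addCases (fun i => congrFun ha0 i) (fun i => congrFun hb0 i) i

theorem R_mul_Uθ : M.R * M.Uθ = 1 := by
  ext i j
  have := congrFun (congrFun (Matrix.mul_nonsing_inv _ h.isUnit_det_T) (Fin.castAdd r₂ i))
    (Fin.castAdd r₂ j)
  simpa [Matrix.mul_apply, T_castAdd, T_natAdd, Uθ, Matrix.one_apply] using this

theorem R_mul_Uγ : M.R * M.Uγ = 0 := by
  ext i j
  have := congrFun (congrFun (Matrix.mul_nonsing_inv _ h.isUnit_det_T) (Fin.castAdd r₂ i))
    (Fin.natAdd r₁ j)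
  rw [Matrix.one_apply_ne (by intro e; have := congrArg Fin.val e; simp at this; omega)] at this
  simpa [Matrix.mul_apply, T_castAdd, T_natAdd, Uγ] using this

theorem nuisance_mul_Uθ : M.nuisance * M.Uθ = 0 := by
  ext i j
  have := congrFun (congrFun (Matrix.mul_nonsing_inv _ h.isUnit_det_T) (Fin.natAdd r₁ i))
    (Fin.castAdd r₂ j)
  rw [Matrix.one_apply_ne (by intro e; have := congrArg Fin.val e; simp at this; omega)] at this
  simpa [Matrix.mul_apply, T_castAdd, T_natAdd, Uθ] using this

theorem nuisance_mul_Uγ : M.nuisance * M.Uγ = 1 := by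
  ext i j
  have := congrFun (congrFun (Matrix.mul_nonsing_inv _ h.isUnit_det_T) (Fin.natAdd r₁ i))
    (Fin.natAdd r₁ j)
  simpa [Matrix.mul_apply, T_castAdd, T_natAdd, Uγ, Matrix.one_apply] using this

/-- Both sides are sent by R to the identity and by D to 0, and T is invertible. -/
theorem Uθ_eq : M.Uθ = M.infoβ⁻¹ * M.Rᵀ * (M.R * M.infoβ⁻¹ * M.Rᵀ)⁻¹ := by
  have hdet : IsUnit (M.R * M.infoβ⁻¹ * M.Rᵀ).det :=
    h.posDef_R_mul_inv_mul_transpose.det_pos.ne'.isUnit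
  have h0 : M.T * (M.Uθ - M.infoβ⁻¹ * M.Rᵀ * (M.R * M.infoβ⁻¹ * M.Rᵀ)⁻¹) = 0 := by
    refine T_mul_eq_zero ?_ ?_
    · rw [Matrix.mul_sub, h.R_mul_Uθ, ← Matrix.mul_assoc, ← Matrix.mul_assoc,
        Matrix.mul_nonsing_inv _ hdet, sub_self]
    · rw [Matrix.mul_sub, h.nuisance_mul_Uθ, ← Matrix.mul_assoc,
        h.nuisance_mul_inv_mul_transpose_R, Matrix.zero_mul, sub_self]
  have h1 := congrArg (fun Y => M.T⁻¹ * Y) h0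
  simp only [Matrix.mul_zero] at h1
  rw [← Matrix.mul_assoc, Matrix.nonsing_inv_mul _ h.isUnit_det_T, Matrix.one_mul] at h1
  exact sub_eq_zero.1 h1

/-- The design matrices of `θ` and `γ` are orthogonal with respect to `Sig⁻¹`. -/
theorem Xγ_transpose_mul_Xθ : M.Xγᵀ * M.Sig⁻¹ * M.Xθ = 0 := by
  have hdet : IsUnit M.infoβ.det := h.posDef_infoβ.det_pos.ne'.isUnit
  -- The factor R' on the left is what the transpose of `Uγ` annihilates, because R `Uγ` = 0.
  have h1 : M.infoβ * M.Uθ = M.Rᵀ * (M.R * M.infoβ⁻¹ * M.Rᵀ)⁻¹ := by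
    rw [h.Uθ_eq, Matrix.mul_assoc, ← Matrix.mul_assoc, Matrix.mul_nonsing_inv _ hdet,
      Matrix.one_mul]
  have h2 : M.Xγᵀ * M.Sig⁻¹ * M.Xθ = M.Uγᵀ * (M.infoβ * M.Uθ) := by
    rw [Xθ_eq, Xγ_eq, infoβ, Matrix.transpose_mul]
    simp only [Matrix.mul_assoc]
  have h3 : M.Uγᵀ * M.Rᵀ = 0 := by
    rw [← Matrix.transpose_mul, h.R_mul_Uγ, Matrix.transpose_zero]
  rw [h2, h1, ← Matrix.mul_assoc, h3, Matrix.zero_mul]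

theorem transpose_Sig_inv : M.Sig⁻¹ᵀ = M.Sig⁻¹ := h.posDef_Sig.inv.transpose_eq

theorem Xθ_transpose_mul_Xγ : M.Xθᵀ * M.Sig⁻¹ * M.Xγ = 0 := by
  have := congrArg Matrix.transpose h.Xγ_transpose_mul_Xθ
  simpa [Matrix.transpose_mul, h.transpose_Sig_inv, Matrix.mul_assoc] using this

theorem posDef_infoθ : M.infoθ.PosDef := by
  have hinj : Function.Injective M.Xθ.mulVec := by
    intro x y hxy
    have hU : M.Uθ *ᵥ x = M.Uθ *ᵥ y :=
      Matrix.mulVec_injective_iff.2 h.linearIndependent_X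
        (by simpa [Xθ_eq, Matrix.mulVec_mulVec] using hxy)
    simpa [Matrix.mulVec_mulVec, h.R_mul_Uθ] using congrArg (fun z => M.R *ᵥ z) hU
  have := h.posDef_Sig.inv.conjTranspose_mul_mul_same hinj
  rwa [Matrix.conjTranspose_eq_transpose_of_trivial] at this

theorem posDef_infoγ : M.infoγ.PosDef := by
  have hinj : Function.Injective M.Xγ.mulVec := by
    intro x y hxy
    have hU : M.Uγ *ᵥ x = M.Uγ *ᵥ y :=
      Matrix.mulVec_injective_iff.2 h.linearIndependent_X
        (by simpa [Xγ_eq, Matrix.mulVec_mulVec] using hxy)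
    simpa [Matrix.mulVec_mulVec, h.nuisance_mul_Uγ] using congrArg (fun z => M.nuisance *ᵥ z) hU
  have := h.posDef_Sig.inv.conjTranspose_mul_mul_same hinj
  rwa [Matrix.conjTranspose_eq_transpose_of_trivial] at this

theorem isUnit_det_infoθ : IsUnit M.infoθ.det := h.posDef_infoθ.det_pos.ne'.isUnit

theorem isUnit_det_infoγ : IsUnit M.infoγ.det := h.posDef_infoγ.det_pos.ne'.isUnit

theorem infoθ_mulVec_θhat (y : Fin n → ℝ) :
    M.infoθ *ᵥ M.θhat y = M.Xθᵀ *ᵥ (M.Sig⁻¹ *ᵥ y) := by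
  rw [θhat, Matrix.mulVec_mulVec, Matrix.mul_nonsing_inv _ h.isUnit_det_infoθ, Matrix.one_mulVec]

theorem infoγ_mulVec_γhat (y : Fin n → ℝ) :
    M.infoγ *ᵥ M.γhat y = M.Xγᵀ *ᵥ (M.Sig⁻¹ *ᵥ y) := by
  rw [γhat, ← infoγ, Matrix.mulVec_mulVec, Matrix.mul_nonsing_inv _ h.isUnit_det_infoγ,
    Matrix.one_mulVec]

theorem Xθ_transpose_mulVec_resid (y : Fin n → ℝ) :
    M.Xθᵀ *ᵥ (M.Sig⁻¹ *ᵥ M.resid y) = 0 := by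
  rw [resid, Matrix.mulVec_sub, Matrix.mulVec_sub, Matrix.mulVec_sub, Matrix.mulVec_sub,
    ← h.infoθ_mulVec_θhat]
  simp only [Matrix.mulVec_mulVec, h.Xθ_transpose_mul_Xγ, ← Matrix.mul_assoc]
  simp [infoθ]

theorem Xγ_transpose_mulVec_resid (y : Fin n → ℝ) :
    M.Xγᵀ *ᵥ (M.Sig⁻¹ *ᵥ M.resid y) = 0 := by
  rw [resid, Matrix.mulVec_sub, Matrix.mulVec_sub, Matrix.mulVec_sub, Matrix.mulVec_sub,
    ← h.infoγ_mulVec_γhat]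
  simp only [Matrix.mulVec_mulVec, h.Xγ_transpose_mul_Xθ, ← Matrix.mul_assoc]
  simp [infoγ]

/-- The orthogonal decomposition of the weighted residual sum of squares. -/
theorem quadForm_sub_mean (y : Fin n → ℝ) (θ : Fin r₁ → ℝ) (γ : Fin r₂ → ℝ) :
    (y - (M.Xθ *ᵥ θ + M.Xγ *ᵥ γ)) ⬝ᵥ (M.Sig⁻¹ *ᵥ (y - (M.Xθ *ᵥ θ + M.Xγ *ᵥ γ)))
      = M.sy2 y + (θ - M.θhat y) ⬝ᵥ (M.infoθ *ᵥ (θ - M.θhat y))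
        + (γ - M.γhat y) ⬝ᵥ (M.infoγ *ᵥ (γ - M.γhat y)) := by
  set a := θ - M.θhat y with ha
  set b := γ - M.γhat y with hb
  have hS := h.transpose_Sig_inv
  have h0 : y - (M.Xθ *ᵥ θ + M.Xγ *ᵥ γ) = M.resid y - (M.Xθ *ᵥ a + M.Xγ *ᵥ b) := by
    rw [ha, hb, resid, Matrix.mulVec_sub, Matrix.mulVec_sub]; abel
  have key : ∀ {p q : ℕ} (P : Matrix (Fin n) (Fin p) ℝ) (Q : Matrix (Fin n) (Fin q) ℝ)
      (u : Fin p → ℝ) (v : Fin q → ℝ),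
      (P *ᵥ u) ⬝ᵥ (M.Sig⁻¹ *ᵥ (Q *ᵥ v)) = u ⬝ᵥ ((Pᵀ * M.Sig⁻¹ * Q) *ᵥ v) := by
    intro p q P Q u v
    rw [← Matrix.mulVec_mulVec, ← Matrix.mulVec_mulVec, dotProduct_comm,
      dotProduct_mulVec_comm P]
  have hθ : M.resid y ⬝ᵥ (M.Sig⁻¹ *ᵥ (M.Xθ *ᵥ a)) = 0 := by
    rw [dotProduct_mulVec_comm, hS, dotProduct_comm, dotProduct_mulVec_comm,
      h.Xθ_transpose_mulVec_resid, dotProduct_zero]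
  have hγ : M.resid y ⬝ᵥ (M.Sig⁻¹ *ᵥ (M.Xγ *ᵥ b)) = 0 := by
    rw [dotProduct_mulVec_comm, hS, dotProduct_comm, dotProduct_mulVec_comm,
      h.Xγ_transpose_mulVec_resid, dotProduct_zero]
  rw [h0, quadForm_sub hS, quadForm_add hS, Matrix.mulVec_add, dotProduct_add, hθ, hγ,
    key M.Xθ M.Xθ, key M.Xγ M.Xγ, key M.Xθ M.Xγ, h.Xθ_transpose_mul_Xγ, Matrix.zero_mulVec,
    dotProduct_zero, sy2, infoθ, infoγ]
  ring

theorem sy2_nonneg (y : Fin n → ℝ) : 0 ≤ M.sy2 y := h.posDef_Sig.inv.quadForm_nonneg _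

/-- Every value of the estimate of `θ` occurs together with every value of `s_y²`. -/
theorem exists_θhat_eq_sy2_eq (hn : r₁ + r₂ < n) (θ₀ : Fin r₁ → ℝ) {S : ℝ} (hS : 0 ≤ S) :
    ∃ y, M.θhat y = θ₀ ∧ M.sy2 y = S := by
  -- Since n exceeds the number of columns of X, some z ≠ 0 is Σ⁻¹-orthogonal to them all. Adding a
  -- multiple of z moves the residual and neither estimate.
  obtain ⟨z, hz, hz0⟩ := Submodule.exists_mem_ne_zero_of_ne_bot
    (LinearMap.ker_ne_bot_of_finrank_lt (f := (M.Xᵀ * M.Sig⁻¹).mulVecLin) (by simpa using hn))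
  have hz' : M.Xᵀ *ᵥ (M.Sig⁻¹ *ᵥ z) = 0 := by
    rw [Matrix.mulVec_mulVec]; exact hz
  have hzθ : M.Xθᵀ *ᵥ (M.Sig⁻¹ *ᵥ z) = 0 := by
    rw [Xθ_eq, Matrix.transpose_mul, ← Matrix.mulVec_mulVec, hz', Matrix.mulVec_zero]
  have hzγ : M.Xγᵀ *ᵥ (M.Sig⁻¹ *ᵥ z) = 0 := by
    rw [Xγ_eq, Matrix.transpose_mul, ← Matrix.mulVec_mulVec, hz', Matrix.mulVec_zero]
  have hzz := h.posDef_Sig.inv.quadForm_pos hz0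
  set t := √(S / (z ⬝ᵥ (M.Sig⁻¹ *ᵥ z))) with ht
  set y := M.Xθ *ᵥ θ₀ + t • z with hy
  have h1 : M.θhat y = θ₀ := by
    rw [θhat, hy, Matrix.mulVec_add, Matrix.mulVec_add, Matrix.mulVec_smul, Matrix.mulVec_smul, hzθ,
      smul_zero, add_zero, Matrix.mulVec_mulVec (M := M.Sig⁻¹), Matrix.mulVec_mulVec (M := M.Xθᵀ),
      ← Matrix.mul_assoc, ← infoθ, Matrix.mulVec_mulVec, Matrix.nonsing_inv_mul _ h.isUnit_det_infoθ, Matrix.one_mulVec]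
  have h2 : M.γhat y = 0 := by
    rw [γhat, hy, Matrix.mulVec_add, Matrix.mulVec_add, Matrix.mulVec_smul, Matrix.mulVec_smul, hzγ,
      smul_zero, add_zero, Matrix.mulVec_mulVec (M := M.Sig⁻¹), Matrix.mulVec_mulVec (M := M.Xγᵀ),
      ← Matrix.mul_assoc, h.Xγ_transpose_mul_Xθ, Matrix.zero_mulVec, Matrix.mulVec_zero]
  have h3 : M.resid y = t • z := by
    rw [resid, h1, h2, Matrix.mulVec_zero, sub_zero, hy, add_sub_cancel_left]
  refine ⟨y, h1, ?_⟩
  rw [sy2, h3, quadForm_smul, ht, Real.sq_sqrt (div_nonneg hS hzz.le), div_mul_cancel₀ _ hzz.ne']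

/-! ### The posterior location and scale -/

theorem posDef_infoθ_add : (M.infoθ + M.Omega⁻¹).PosDef := h.posDef_infoθ.add h.posDef_Omega.inv

theorem posDef_limitScale : M.limitScale.PosDef := h.posDef_infoθ_add.inv

theorem limitScale_inv : M.limitScale⁻¹ = M.infoθ + M.Omega⁻¹ :=
  Matrix.nonsing_inv_nonsing_inv _ h.posDef_infoθ_add.det_pos.ne'.isUnit

theorem posDef_inv_add_Omega : (M.infoθ⁻¹ + M.Omega).PosDef :=
  h.posDef_infoθ.inv.add h.posDef_Omega

/-- A Woodbury identity, resting on (A⁻¹ + Ω)A = Ω(A + Ω⁻¹). -/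
theorem inv_add_Omega_inv :
    (M.infoθ⁻¹ + M.Omega)⁻¹ = M.infoθ - M.infoθ * M.limitScale * M.infoθ := by
  refine Matrix.inv_eq_right_inv ?_
  have hΩ : IsUnit M.Omega.det := h.posDef_Omega.det_pos.ne'.isUnit
  have hB : IsUnit (M.infoθ + M.Omega⁻¹).det := h.posDef_infoθ_add.det_pos.ne'.isUnit
  have h1 : (M.infoθ⁻¹ + M.Omega) * M.infoθ = M.Omega * (M.infoθ + M.Omega⁻¹) := by
    rw [Matrix.add_mul, Matrix.mul_add, Matrix.nonsing_inv_mul _ h.isUnit_det_infoθ,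
      Matrix.mul_nonsing_inv _ hΩ, add_comm]
  rw [Matrix.mul_sub, ← Matrix.mul_assoc, ← Matrix.mul_assoc, h1, limitScale,
    Matrix.mul_assoc M.Omega, Matrix.mul_nonsing_inv _ hB, Matrix.mul_one, Matrix.mul_add,
    Matrix.mul_nonsing_inv _ hΩ, add_sub_cancel_left]

/-- Completing the square. -/
theorem quadForm_add_prior (θ t : Fin r₁ → ℝ) :
    (θ - t) ⬝ᵥ (M.infoθ *ᵥ (θ - t)) + θ ⬝ᵥ (M.Omega⁻¹ *ᵥ θ)
      = t ⬝ᵥ ((M.infoθ⁻¹ + M.Omega)⁻¹ *ᵥ t) +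
        (θ - M.limitScale *ᵥ (M.infoθ *ᵥ t)) ⬝ᵥ
          (M.limitScale⁻¹ *ᵥ (θ - M.limitScale *ᵥ (M.infoθ *ᵥ t))) := by
  have hV : IsUnit M.limitScale.det := h.posDef_limitScale.det_pos.ne'.isUnit
  set m := M.limitScale *ᵥ (M.infoθ *ᵥ t) with hm
  have h1 : M.limitScale⁻¹ *ᵥ m = M.infoθ *ᵥ t := by
    rw [hm, Matrix.mulVec_mulVec, Matrix.nonsing_inv_mul _ hV, Matrix.one_mulVec]
  have h2 : t ⬝ᵥ ((M.infoθ⁻¹ + M.Omega)⁻¹ *ᵥ t) = t ⬝ᵥ (M.infoθ *ᵥ t) - m ⬝ᵥ (M.infoθ *ᵥ t) := by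
    rw [h.inv_add_Omega_inv, Matrix.sub_mulVec, dotProduct_sub, dotProduct_mulVec_comm _ m,
      h.posDef_infoθ.transpose_eq, hm, ← Matrix.mulVec_mulVec, ← Matrix.mulVec_mulVec]
  rw [quadForm_sub h.posDef_infoθ.transpose_eq, quadForm_sub h.posDef_limitScale.inv.transpose_eq,
    h1, h2, h.limitScale_inv, Matrix.add_mulVec, dotProduct_add]
  ring

theorem quadForm_location (t : Fin r₁ → ℝ) :
    (M.limitScale *ᵥ (M.infoθ *ᵥ t)) ⬝ᵥ (M.limitScale⁻¹ *ᵥ (M.limitScale *ᵥ (M.infoθ *ᵥ t)))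
      = t ⬝ᵥ ((M.infoθ * M.limitScale * M.infoθ) *ᵥ t) := by
  have hV : IsUnit M.limitScale.det := h.posDef_limitScale.det_pos.ne'.isUnit
  rw [Matrix.mulVec_mulVec _ M.limitScale⁻¹, Matrix.nonsing_inv_mul _ hV, Matrix.one_mulVec,
    dotProduct_mulVec_comm, h.posDef_infoθ.transpose_eq, ← Matrix.mulVec_mulVec,
    ← Matrix.mulVec_mulVec]

end IsRegular

end OneSidedTest

/-! ### The multivariate normal density -/

theorem mvNormalPDF_nonneg {k : ℕ} (μ : Fin k → ℝ) (V : Matrix (Fin k) (Fin k) ℝ) (x : Fin k → ℝ) :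
    0 ≤ mvNormalPDF μ V x := by
  unfold mvNormalPDF; positivity

theorem mvNormalPDF_smul {k : ℕ} (μ : Fin k → ℝ) {V : Matrix (Fin k) (Fin k) ℝ} (hV : V.PosDef)
    {w : ℝ} (hw : 0 < w) (x : Fin k → ℝ) :
    mvNormalPDF μ (w • V) x = (√((2 * Real.pi) ^ k * V.det))⁻¹ * w ^ (-(k / 2 : ℝ)) *
      Real.exp (-((x - μ) ⬝ᵥ (V⁻¹ *ᵥ (x - μ))) / (2 * w)) := by
  have hdet : IsUnit V.det := hV.det_pos.ne'.isUnit
  have hinv : (w • V)⁻¹ = w⁻¹ • V⁻¹ := by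
    refine Matrix.inv_eq_right_inv ?_
    rw [Matrix.smul_mul, Matrix.mul_smul, smul_smul, mul_inv_cancel₀ hw.ne', one_smul,
      Matrix.mul_nonsing_inv _ hdet]
  have hsqrt : √((2 * Real.pi) ^ k * (w • V).det)
      = √((2 * Real.pi) ^ k * V.det) * w ^ (k / 2 : ℝ) := by
    rw [Matrix.det_smul, Fintype.card_fin, mul_left_comm, Real.sqrt_mul (by positivity), mul_comm]
    congr 1
    rw [Real.sqrt_eq_rpow, ← Real.rpow_natCast, ← Real.rpow_mul hw.le]
    congr 1; ring
  rw [mvNormalPDF, hinv, hsqrt, Matrix.smul_mulVec, dotProduct_smul, smul_eq_mul, mul_inv,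
    Real.rpow_neg hw.le]
  congr 2
  field_simp

theorem lintegral_mvNormalPDF {k : ℕ} (μ : Fin k → ℝ) {V : Matrix (Fin k) (Fin k) ℝ}
    (hV : V.PosDef) : ∫⁻ x, ENNReal.ofReal (mvNormalPDF μ V x) = 1 := by
  have hdet := hV.det_pos
  have hπ := Real.pi_pos
  have hpt : ∀ x, ENNReal.ofReal (mvNormalPDF μ V x)
      = ENNReal.ofReal (√((2 * Real.pi) ^ k * V.det))⁻¹ *
        ENNReal.ofReal (Real.exp (-(1 / 2 * ((x - μ) ⬝ᵥ (V⁻¹ *ᵥ (x - μ)))))) := by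
    intro x
    rw [← ENNReal.ofReal_mul (by positivity), mvNormalPDF]
    congr 3; ring
  simp_rw [hpt]
  rw [lintegral_const_mul' _ _ ENNReal.ofReal_ne_top,
    lintegral_exp_neg_quadForm hV.inv μ (by norm_num), ← ENNReal.ofReal_mul (by positivity),
    ← ENNReal.ofReal_one]
  congr 1
  have h : √((2 * Real.pi) ^ k * V.det)
      = √(Real.pi ^ k / V⁻¹.det) * (1 / 2 : ℝ) ^ (-(k / 2 : ℝ)) := by
    rw [Matrix.det_nonsing_inv, Ring.inverse_eq_inv', div_inv_eq_mul, mul_pow, mul_assoc,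
      Real.sqrt_mul (by positivity), mul_comm]
    congr 1
    rw [one_div, Real.inv_rpow (by norm_num), Real.rpow_neg (by norm_num), inv_inv,
      Real.sqrt_eq_rpow, ← Real.rpow_natCast, ← Real.rpow_mul (by norm_num)]
    congr 1; ring
  rw [← h, inv_mul_cancel₀ (by positivity)]

/-! ### Orthants -/

theorem smul_mem_Iic_zero_iff {k : ℕ} {r : ℝ} (hr : 0 < r) (x : Fin k → ℝ) :
    r • x ∈ Set.Iic (0 : Fin k → ℝ) ↔ x ∈ Set.Iic (0 : Fin k → ℝ) := by
  simp only [Set.mem_Iic, Pi.le_def, Pi.smul_apply, Pi.zero_apply, smul_eq_mul]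
  exact forall_congr' fun i => ⟨fun hx => by nlinarith, fun hx => by nlinarith⟩

theorem smul_mem_compl_Iic_zero_iff {k : ℕ} {r : ℝ} (hr : 0 < r) (x : Fin k → ℝ) :
    r • x ∈ (Set.Iic (0 : Fin k → ℝ))ᶜ ↔ x ∈ (Set.Iic (0 : Fin k → ℝ))ᶜ :=
  not_congr (smul_mem_Iic_zero_iff hr x)

theorem exists_isOpen_subset_Iic_zero (k : ℕ) :
    ∃ U : Set (Fin k → ℝ), IsOpen U ∧ U.Nonempty ∧ U ⊆ Set.Iic 0 :=
  ⟨Set.univ.pi fun _ => Set.Iio 0, isOpen_set_pi Set.finite_univ fun _ _ => isOpen_Iio,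
    ⟨fun _ => -1, fun _ _ => by simp⟩, fun _ hx i => le_of_lt (hx i trivial)⟩

/-! ### The posterior of θ as a t distribution on cones -/

namespace OneSidedTest

variable {n r₁ r₂ : ℕ} {M : OneSidedTest n r₁ r₂}

variable (M) in
/-- The quadratic form of `(Xθ' Sig⁻¹ Xθ)⁻¹ + Omega` in the estimate of `θ`, plus the sums of
squares of the data and of the prior. -/
noncomputable def postScale (y : Fin n → ℝ) : ℝ :=
  M.sy2 y + M.nu * M.s2 + M.θhat y ⬝ᵥ ((M.infoθ⁻¹ + M.Omega)⁻¹ *ᵥ M.θhat y)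

variable (M) in
/-- The location of the posterior distribution of `θ`, rescaled to the scale matrix
`limitScale`. -/
noncomputable def postLoc (y : Fin n → ℝ) : Fin r₁ → ℝ :=
  (√(M.postScale y / M.dof))⁻¹ • (M.limitScale *ᵥ (M.infoθ *ᵥ M.θhat y))

theorem dof_pos (hn : r₁ + r₂ < n) (hnu : 0 ≤ M.nu) : 0 < M.dof := by
  have : ((r₁ + r₂ : ℕ) : ℝ) < n := by exact_mod_cast hn
  push_cast at this
  have h1 : (0 : ℝ) ≤ r₁ := by positivity
  rw [dof]; linarith

namespace IsRegular

variable (h : M.IsRegular)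
include h

theorem integrand_eq (y : Fin n → ℝ) (θ : Fin r₁ → ℝ) (γ : Fin r₂ → ℝ) {w : ℝ} (hw : 0 < w) :
    M.likelihood y θ γ w * (M.priorθ w θ * invChiSqKernel M.s2 M.nu w)
      = ((√((2 * Real.pi) ^ n * M.Sig.det))⁻¹ * (√((2 * Real.pi) ^ r₁ * M.Omega.det))⁻¹) *
        w ^ (-(((n + r₁ + M.nu) / 2 : ℝ) + 1)) *
        (Real.exp (-((M.sy2 y + M.nu * M.s2 + ((θ - M.θhat y) ⬝ᵥ (M.infoθ *ᵥ (θ - M.θhat y)) +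
          θ ⬝ᵥ (M.Omega⁻¹ *ᵥ θ))) / 2 / w)) *
        Real.exp (-((2 * w)⁻¹ * ((γ - M.γhat y) ⬝ᵥ (M.infoγ *ᵥ (γ - M.γhat y)))))) := by
  rw [likelihood, priorθ, invChiSqKernel, mvNormalPDF_smul _ h.posDef_Sig hw,
    mvNormalPDF_smul _ h.posDef_Omega hw, h.quadForm_sub_mean, sub_zero]
  have hpow : w ^ (-(((n + r₁ + M.nu) / 2 : ℝ) + 1))
      = w ^ (-(n / 2 : ℝ)) * w ^ (-(r₁ / 2 : ℝ)) * w ^ (-(M.nu / 2 + 1)) := by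
    rw [← Real.rpow_add hw, ← Real.rpow_add hw]; congr 1; ring
  rw [hpow, ← Real.exp_add]
  rw [show ∀ a b p q r e f g : ℝ, a * p * e * (b * q * f * (r * g))
    = a * b * (p * q * r) * (e * (f * g)) by intros; ring, ← Real.exp_add, ← Real.exp_add]
  congr 2
  field_simp
  ring

/-- After swapping the integrals, the one over γ is Gaussian and the one over σ² is inverse gamma.
The factor K depends on neither the data nor θ, so it cancels from every posterior ratio. -/
theorem exists_lintegral_eq (hn : r₁ + r₂ < n) (hnu : 0 ≤ M.nu) :
    ∃ K : ℝ, 0 < K ∧ ∀ (y : Fin n → ℝ) (θ : Fin r₁ → ℝ) (q : ℝ),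
      q = M.sy2 y + M.nu * M.s2 + ((θ - M.θhat y) ⬝ᵥ (M.infoθ *ᵥ (θ - M.θhat y)) +
          θ ⬝ᵥ (M.Omega⁻¹ *ᵥ θ)) → 0 < q →
      ∫⁻ γ : Fin r₂ → ℝ, ∫⁻ w in Set.Ioi (0 : ℝ),
        ENNReal.ofReal (M.likelihood y θ γ w * (M.priorθ w θ * invChiSqKernel M.s2 M.nu w))
        = ENNReal.ofReal K * ENNReal.ofReal (q ^ (-((M.dof + r₁) / 2))) := by
  have hd := dof_pos hn hnu
  set a : ℝ := (M.dof + r₁) / 2 with ha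
  have ha0 : 0 < a := by positivity
  have hS := h.posDef_Sig.det_pos
  have hO := h.posDef_Omega.det_pos
  have hC := h.posDef_infoγ.det_pos
  have hπ := Real.pi_pos
  have hΓ := Real.Gamma_pos_of_pos ha0
  set c₁ : ℝ := (√((2 * Real.pi) ^ n * M.Sig.det))⁻¹ * (√((2 * Real.pi) ^ r₁ * M.Omega.det))⁻¹
    with hc₁
  have hc₁0 : 0 < c₁ := by positivity
  set c₂ : ℝ := √(Real.pi ^ r₂ / M.infoγ.det) * 2 ^ (r₂ / 2 : ℝ) with hc₂
  have hc₂0 : 0 < c₂ := by positivity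
  refine ⟨c₁ * c₂ * Real.Gamma a * 2 ^ a, by positivity, fun y θ q hq hq0 => ?_⟩
  set g : (Fin r₂ → ℝ) → ℝ := fun γ => (γ - M.γhat y) ⬝ᵥ (M.infoγ *ᵥ (γ - M.γhat y)) with hg
  have hgm : Measurable g := measurable_quadForm _ _
  set e : ℝ := (n + r₁ + M.nu) / 2 with he
  have h1 : ∀ γ, ∫⁻ w in Set.Ioi (0 : ℝ),
      ENNReal.ofReal (M.likelihood y θ γ w * (M.priorθ w θ * invChiSqKernel M.s2 M.nu w))
      = ∫⁻ w in Set.Ioi (0 : ℝ), ENNReal.ofReal (c₁ * w ^ (-(e + 1)) *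
        (Real.exp (-(q / 2 / w)) * Real.exp (-((2 * w)⁻¹ * g γ)))) := by
    intro γ
    refine setLIntegral_congr_fun measurableSet_Ioi fun w hw => ?_
    simp only [h.integrand_eq y θ γ hw, hq, hg, he, hc₁]
  simp_rw [h1]
  rw [lintegral_lintegral_swap (by
    have : Measurable fun p : (Fin r₂ → ℝ) × ℝ => c₁ * p.2 ^ (-(e + 1)) *
        (Real.exp (-(q / 2 / p.2)) * Real.exp (-((2 * p.2)⁻¹ * g p.1))) := by fun_prop
    exact this.ennreal_ofReal.aemeasurable)]
  have h2 : ∀ w ∈ Set.Ioi (0 : ℝ), ∫⁻ γ, ENNReal.ofReal (c₁ * w ^ (-(e + 1)) *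
        (Real.exp (-(q / 2 / w)) * Real.exp (-((2 * w)⁻¹ * g γ))))
      = ENNReal.ofReal (c₁ * c₂) *
        ENNReal.ofReal (w ^ (-(a + 1)) * Real.exp (-(q / 2 / w))) := by
    intro w hw
    have hw' : 0 < w := hw
    have h3 : ∀ γ, ENNReal.ofReal (c₁ * w ^ (-(e + 1)) *
        (Real.exp (-(q / 2 / w)) * Real.exp (-((2 * w)⁻¹ * g γ))))
        = ENNReal.ofReal (c₁ * w ^ (-(e + 1)) * Real.exp (-(q / 2 / w))) *
          ENNReal.ofReal (Real.exp (-((2 * w)⁻¹ * g γ))) := by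
      intro γ
      rw [← ENNReal.ofReal_mul (by positivity), mul_assoc (c₁ * w ^ (-(e + 1)))]
    simp_rw [h3]
    rw [lintegral_const_mul' _ _ ENNReal.ofReal_ne_top,
      lintegral_exp_neg_quadForm h.posDef_infoγ _ (by positivity),
      ← ENNReal.ofReal_mul (by positivity), ← ENNReal.ofReal_mul (by positivity)]
    congr 1
    have h4 : ((2 * w)⁻¹ : ℝ) ^ (-(r₂ / 2 : ℝ)) = 2 ^ (r₂ / 2 : ℝ) * w ^ (r₂ / 2 : ℝ) := by
      rw [Real.inv_rpow (by positivity), Real.rpow_neg (by positivity), inv_inv,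
        Real.mul_rpow (by norm_num) hw'.le]
    -- The Gaussian integral over γ returns w^(r₂/2); this is the loss of r₂ degrees of freedom in
    -- `dof`.
    have h5 : w ^ (-(a + 1)) = w ^ (-(e + 1)) * w ^ (r₂ / 2 : ℝ) := by
      rw [← Real.rpow_add hw']; congr 1; rw [ha, he, dof]; ring
    rw [h4, h5, hc₂]; ring
  rw [setLIntegral_congr_fun measurableSet_Ioi h2, lintegral_const_mul' _ _ ENNReal.ofReal_ne_top,
    lintegral_inv_gamma ha0 (by positivity), ← ENNReal.ofReal_mul (by positivity),
    ← ENNReal.ofReal_mul (by positivity)]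
  congr 1
  rw [Real.div_rpow hq0.le (by norm_num), Real.rpow_neg (by norm_num : (0 : ℝ) ≤ 2), div_inv_eq_mul]
  ring

/-- The posterior of `θ` on cones is, up to scale, a multivariate `t` distribution. -/
theorem exists_posteriorMass_eq (hn : r₁ + r₂ < n) (hnu : 0 ≤ M.nu) {y : Fin n → ℝ}
    (hκ : 0 < M.postScale y) :
    ∃ K : ℝ≥0∞, K ≠ 0 ∧ K ≠ ∞ ∧ ∀ A : Set (Fin r₁ → ℝ), MeasurableSet A →
      (∀ r : ℝ, 0 < r → ∀ x, r • x ∈ A ↔ x ∈ A) →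
      M.posteriorMass y A = K * mvStudent (M.postLoc y) M.limitScale M.dof A := by
  obtain ⟨K₀, hK₀, hK⟩ := h.exists_lintegral_eq hn hnu
  obtain ⟨K₁, hK₁0, hK₁t, hK₁⟩ := exists_setLIntegral_cone_eq_mvStudent h.posDef_limitScale
    (dof_pos hn hnu) hκ (M.limitScale *ᵥ (M.infoθ *ᵥ M.θhat y))
  refine ⟨ENNReal.ofReal K₀ * K₁, mul_ne_zero (by simpa using hK₀) hK₁0,
    ENNReal.mul_ne_top ENNReal.ofReal_ne_top hK₁t, fun A hA hcone => ?_⟩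
  rw [mul_assoc, postLoc, ← hK₁ A hA hcone, ← lintegral_const_mul' _ _ ENNReal.ofReal_ne_top,
    posteriorMass]
  refine lintegral_congr fun θ => hK y θ _ ?_ ?_
  · rw [h.quadForm_add_prior, postScale]; ring
  · exact add_pos_of_pos_of_nonneg hκ (h.posDef_limitScale.inv.quadForm_nonneg _)

theorem posteriorProb_eq (hn : r₁ + r₂ < n) (hnu : 0 ≤ M.nu) {y : Fin n → ℝ}
    (hκ : 0 < M.postScale y) :
    M.posteriorProb y (Set.Iic 0)
      = (mvStudent (M.postLoc y) M.limitScale M.dof).real (Set.Iic 0) := by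
  obtain ⟨K, hK0, hKt, hK⟩ := h.exists_posteriorMass_eq hn hnu hκ
  have := isProbabilityMeasure_mvStudent h.posDef_limitScale (dof_pos hn hnu) (M.postLoc y)
  rw [posteriorProb, hK _ measurableSet_Iic fun r hr => smul_mem_Iic_zero_iff hr,
    hK _ MeasurableSet.univ fun r hr x => by simp, measure_univ, mul_one,
    mul_comm, ENNReal.mul_div_cancel_right hK0 hKt, Measure.real]

/-! ### Bounds uniform in the data -/

/-- The source of the inconsistency: numerator and denominator are both quadratic in θhat, and the
denominator `postScale` is at least a positive definite form in it, so the quotient stays bounded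
however extreme the data. -/
theorem quadForm_postLoc_le (hn : r₁ + r₂ < n) (hs2 : 0 < M.s2) (hnu : 0 ≤ M.nu) :
    ∃ C : ℝ, 0 ≤ C ∧ ∀ y, 0 < M.postScale y →
      M.postLoc y ⬝ᵥ (M.limitScale⁻¹ *ᵥ M.postLoc y) / M.dof ≤ C := by
  obtain ⟨C, hC0, hC⟩ := h.posDef_inv_add_Omega.inv.exists_quadForm_le
    (M.infoθ * M.limitScale * M.infoθ)
  refine ⟨C, hC0, fun y hκ => ?_⟩
  have hd := dof_pos hn hnu
  rw [postLoc, quadForm_smul, h.quadForm_location, inv_pow, Real.sq_sqrt (by positivity), inv_div,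
    div_mul_eq_mul_div, div_div, div_le_iff₀ (by positivity)]
  have h1 := hC (M.θhat y)
  have h2 : M.θhat y ⬝ᵥ ((M.infoθ⁻¹ + M.Omega)⁻¹ *ᵥ M.θhat y) ≤ M.postScale y := by
    have := h.sy2_nonneg y
    have := mul_nonneg hnu hs2.le
    rw [postScale]; linarith
  have h3 := h1.trans (mul_le_mul_of_nonneg_left h2 hC0)
  nlinarith [mul_le_mul_of_nonneg_left h3 hd.le]

/-- Over all data, the posterior `t` distributions give mass bounded below to any set with
interior points. -/
theorem exists_le_mvStudent_postLoc (hn : r₁ + r₂ < n) (hs2 : 0 < M.s2) (hnu : 0 ≤ M.nu)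
    {A U : Set (Fin r₁ → ℝ)} (hA : MeasurableSet A) (hU : IsOpen U) (hne : U.Nonempty)
    (hUA : U ⊆ A) :
    ∃ ε : ℝ, 0 < ε ∧ ∀ y, 0 < M.postScale y →
      ε ≤ (mvStudent (M.postLoc y) M.limitScale M.dof).real A := by
  obtain ⟨C, hC0, hC⟩ := h.quadForm_postLoc_le hn hs2 hnu
  have hd := dof_pos hn hnu
  have hV := h.posDef_limitScale
  have hL : 0 < (2 + 2 * C) ^ ((M.dof + r₁) / 2) := by positivity
  refine ⟨((2 + 2 * C) ^ ((M.dof + r₁) / 2))⁻¹ * (mvStudent 0 M.limitScale M.dof).real A,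
    mul_pos (inv_pos.2 hL) (mvStudent_real_pos hV hd 0 hU hne hUA), fun y hκ => ?_⟩
  rw [inv_mul_le_iff₀ hL]
  refine (mvStudent_real_le_mul hV hd 0 (M.postLoc y) hA).trans
    (mul_le_mul_of_nonneg_right (Real.rpow_le_rpow ?_ ?_ (by positivity)) measureReal_nonneg)
  · have := div_nonneg (hV.inv.quadForm_nonneg (M.postLoc y - 0)) hd.le
    linarith
  · have := hC y hκ
    rw [sub_zero]; linarith

theorem exists_le_posterior (hr₁ : 0 < r₁) (hn : r₁ + r₂ < n) (hs2 : 0 < M.s2) (hnu : 0 ≤ M.nu) :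
    ∃ ε : ℝ, 0 < ε ∧ ∀ y, 0 < M.postScale y →
      ε ≤ (mvStudent (M.postLoc y) M.limitScale M.dof).real (Set.Iic 0) ∧
      ε ≤ (mvStudent (M.postLoc y) M.limitScale M.dof).real (Set.Iic 0)ᶜ := by
  obtain ⟨U, hU, hne, hsub⟩ := exists_isOpen_subset_Iic_zero r₁
  obtain ⟨ε₁, h₁, H₁⟩ := h.exists_le_mvStudent_postLoc hn hs2 hnu measurableSet_Iic hU hne hsub
  -- The complement is open, and contains the all-ones vector because r₁ > 0; for r₁ = 0 it would be
  -- empty.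
  obtain ⟨ε₂, h₂, H₂⟩ := h.exists_le_mvStudent_postLoc hn hs2 hnu
    (measurableSet_Iic (a := (0 : Fin r₁ → ℝ))).compl isClosed_Iic.isOpen_compl
    ⟨fun _ => 1, fun hx => absurd (hx ⟨0, hr₁⟩) (by simp)⟩ subset_rfl
  exact ⟨min ε₁ ε₂, lt_min h₁ h₂, fun y hκ =>
    ⟨(min_le_left _ _).trans (H₁ y hκ), (min_le_right _ _).trans (H₂ y hκ)⟩⟩

theorem postScale_pos_of_θhat_ne_zero (hs2 : 0 < M.s2) (hnu : 0 ≤ M.nu) {y : Fin n → ℝ}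
    (hy : M.θhat y ≠ 0) : 0 < M.postScale y := by
  have h1 := h.sy2_nonneg y
  have h2 := mul_nonneg hnu hs2.le
  have h3 := h.posDef_inv_add_Omega.inv.quadForm_pos hy
  rw [postScale]; linarith

/-- When ν = 0 the scale vanishes only if θhat and the residual both do, and then y = Xγ γhat. -/
theorem postScale_pos (hs2 : 0 < M.s2) (hnu : 0 ≤ M.nu) {y : Fin n → ℝ}
    (hy : 0 < M.nu ∨ ∀ γ : Fin r₂ → ℝ, y ≠ M.Xγ *ᵥ γ) : 0 < M.postScale y := by
  by_cases hθ : M.θhat y = 0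
  · have h3 := h.posDef_inv_add_Omega.inv.quadForm_nonneg (M.θhat y)
    rcases hy with hν | hγ
    · have h1 := h.sy2_nonneg y
      have h2 := mul_pos hν hs2
      rw [postScale]; linarith
    · have hres : M.resid y ≠ 0 := by
        intro h0
        apply hγ (M.γhat y)
        rw [resid, hθ, Matrix.mulVec_zero, sub_zero] at h0
        exact sub_eq_zero.1 h0
      have h1 : 0 < M.sy2 y := h.posDef_Sig.inv.quadForm_pos hres
      have h2 := mul_nonneg hnu hs2.le
      rw [postScale]; linarith
  · exact h.postScale_pos_of_θhat_ne_zero hs2 hnu hθ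

/-! ### The Bayes factor -/

/-- The prior probability of a cone does not depend on `σ²`. -/
theorem priorProb_eq {A : Set (Fin r₁ → ℝ)} (hA : MeasurableSet A)
    (hcone : ∀ r : ℝ, 0 < r → ∀ x, r • x ∈ A ↔ x ∈ A) {w : ℝ} (hw : 0 < w) :
    M.priorProb w A = M.priorProb 1 A := by
  have hsw : 0 < √w := Real.sqrt_pos.2 hw
  have hmeas : Measurable fun θ => ENNReal.ofReal (M.priorθ w θ) := by
    have : Continuous fun θ => M.priorθ w θ := by unfold priorθ mvNormalPDF; fun_prop
    exact this.measurable.ennreal_ofReal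
  -- Rescaling θ by √w maps N(0, wΩ) to N(0, Ω) and preserves the cone.
  rw [priorProb, setLIntegral_cone_comp_smul hA hsw (hcone _ hsw) hmeas, priorProb,
    ← lintegral_const_mul' _ _ ENNReal.ofReal_ne_top]
  refine lintegral_congr fun θ => ?_
  rw [← ENNReal.ofReal_mul (by positivity)]
  congr 1
  rw [priorθ, priorθ, mvNormalPDF_smul _ h.posDef_Omega hw,
    mvNormalPDF_smul _ h.posDef_Omega one_pos, sub_zero, sub_zero, quadForm_smul,
    Real.sq_sqrt hw.le, Real.one_rpow]
  have h1 : √w ^ r₁ * w ^ (-(r₁ / 2 : ℝ)) = 1 := by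
    rw [Real.sqrt_eq_rpow, ← Real.rpow_natCast, ← Real.rpow_mul hw.le, ← Real.rpow_add hw]
    rw [show (1 / 2 * r₁ + -(r₁ / 2) : ℝ) = 0 by ring, Real.rpow_zero]
  have h2 : -(w * (θ ⬝ᵥ (M.Omega⁻¹ *ᵥ θ))) / (2 * w) = -(θ ⬝ᵥ (M.Omega⁻¹ *ᵥ θ)) / (2 * 1) := by
    field_simp
  rw [h2, ← mul_assoc, mul_left_comm, h1]

theorem priorProb_le_one (A : Set (Fin r₁ → ℝ)) : M.priorProb 1 A ≤ 1 := by
  rw [priorProb, ← lintegral_mvNormalPDF 0 (h.posDef_Omega.smul (one_pos : (0 : ℝ) < 1))]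
  exact setLIntegral_le_lintegral _ _

theorem priorProb_ne_zero {A U : Set (Fin r₁ → ℝ)} (hU : IsOpen U) (hne : U.Nonempty)
    (hUA : U ⊆ A) : M.priorProb 1 A ≠ 0 := by
  have hcont : Continuous fun θ => M.priorθ 1 θ := by unfold priorθ mvNormalPDF; fun_prop
  have hO := h.posDef_Omega.det_pos
  have hπ := Real.pi_pos
  have hsupp : Function.support (fun θ => ENNReal.ofReal (M.priorθ 1 θ)) = Set.univ := by
    refine Set.eq_univ_of_forall fun θ => ?_
    rw [Function.mem_support, Ne, ENNReal.ofReal_eq_zero, not_le, priorθ,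
      mvNormalPDF_smul _ h.posDef_Omega one_pos]
    positivity
  rw [priorProb, ← pos_iff_ne_zero, setLIntegral_pos_iff hcont.measurable.ennreal_ofReal, hsupp,
    Set.univ_inter]
  exact (hU.measure_pos _ hne).trans_le (measure_mono hUA)

/-- On a cone the normalising constant of the truncated prior is free of σ², so it leaves the
integral. -/
theorem marginal_eq {A : Set (Fin r₁ → ℝ)} (hA : MeasurableSet A)
    (hcone : ∀ r : ℝ, 0 < r → ∀ x, r • x ∈ A ↔ x ∈ A) (hp : M.priorProb 1 A ≠ 0)
    (y : Fin n → ℝ) :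
    M.marginal A y = (M.priorProb 1 A)⁻¹ * M.posteriorMass y A := by
  have hp' : (M.priorProb 1 A)⁻¹ ≠ ∞ := ENNReal.inv_ne_top.2 hp
  rw [marginal, posteriorMass, ← lintegral_const_mul' _ _ hp', ← lintegral_indicator hA]
  refine lintegral_congr fun θ => ?_
  by_cases hθ : θ ∈ A
  · rw [Set.indicator_of_mem hθ, ← lintegral_const_mul' _ _ hp']
    refine lintegral_congr fun γ => ?_
    rw [← lintegral_const_mul' _ _ hp']
    refine setLIntegral_congr_fun measurableSet_Ioi fun w hw => ?_
    simp only [truncPriorθ, Set.indicator_of_mem hθ]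
    have hL : 0 ≤ M.likelihood y θ γ w := mvNormalPDF_nonneg _ _ _
    have hP : 0 ≤ M.priorθ w θ := mvNormalPDF_nonneg _ _ _
    rw [h.priorProb_eq hA hcone hw, ENNReal.ofReal_mul hL, ENNReal.ofReal_mul hP, div_eq_mul_inv]
    ring
  · simp [truncPriorθ, Set.indicator_of_notMem hθ]

theorem exists_le_B10 (hr₁ : 0 < r₁) (hn : r₁ + r₂ < n) (hs2 : 0 < M.s2) (hnu : 0 ≤ M.nu) :
    ∃ δ : ℝ≥0∞, δ ≠ 0 ∧ ∀ y, 0 < M.postScale y → δ ≤ M.B10 y := by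
  obtain ⟨ε, hε, hle⟩ := h.exists_le_posterior hr₁ hn hs2 hnu
  obtain ⟨U, hU, hne, hsub⟩ := exists_isOpen_subset_Iic_zero r₁
  have hp₀ := h.priorProb_ne_zero hU hne hsub
  have hp₁ : M.priorProb 1 (Set.Iic 0)ᶜ ≠ 0 := h.priorProb_ne_zero isClosed_Iic.isOpen_compl
    ⟨fun _ => 1, fun hx => absurd (hx ⟨0, hr₁⟩) (by simp)⟩ subset_rfl
  -- In the odds, the posterior mass of the complement is at least Kε and that of the orthant at
  -- most K. The prior probability of the complement is at most 1, so only that of the orthant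
  -- appears.
  refine ⟨ENNReal.ofReal ε * M.priorProb 1 (Set.Iic 0),
    mul_ne_zero (by simpa using hε) hp₀, fun y hκ => ?_⟩
  obtain ⟨K, hK0, hKt, hK⟩ := h.exists_posteriorMass_eq hn hnu hκ
  have := isProbabilityMeasure_mvStudent h.posDef_limitScale (dof_pos hn hnu) (M.postLoc y)
  have hcone₀ := fun (r : ℝ) (hr : 0 < r) => smul_mem_Iic_zero_iff (k := r₁) hr
  have hcone₁ := fun (r : ℝ) (hr : 0 < r) => smul_mem_compl_Iic_zero_iff (k := r₁) hr
  have hmeas : MeasurableSet (Set.Iic (0 : Fin r₁ → ℝ)) := measurableSet_Iic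
  have h1 : K * ENNReal.ofReal ε ≤ M.marginal (Set.Iic 0)ᶜ y := by
    rw [h.marginal_eq hmeas.compl hcone₁ hp₁, hK _ hmeas.compl hcone₁]
    refine le_trans ?_ (le_mul_of_one_le_left' (ENNReal.one_le_inv.2 (h.priorProb_le_one _)))
    gcongr
    exact ENNReal.ofReal_le_of_le_toReal (hle y hκ).2
  have h2 : M.marginal (Set.Iic 0) y ≤ K * (M.priorProb 1 (Set.Iic 0))⁻¹ := by
    rw [h.marginal_eq hmeas hcone₀ hp₀, hK _ hmeas hcone₀, mul_left_comm]
    gcongr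
    exact mul_le_of_le_one_right' prob_le_one
  rw [B10]
  refine le_trans (le_of_eq ?_) (ENNReal.div_le_div h1 h2)
  rw [ENNReal.mul_div_mul_left _ _ hK0 hKt, div_eq_mul_inv, inv_inv]

theorem not_informationConsistent_B10 (hr₁ : 0 < r₁) (hn : r₁ + r₂ < n) (hs2 : 0 < M.s2)
    (hnu : 0 ≤ M.nu) {S : ℝ} (hS : 0 ≤ S) : ¬ M.InformationConsistent M.B10 S := by
  intro hcons
  obtain ⟨δ, hδ, hle⟩ := h.exists_le_B10 hr₁ hn hs2 hnu
  -- The clause B → 0 is refuted: all coordinates of θhat equal -(i + 1) while s_y² = S. The offset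
  -- 1 keeps θhat nonzero at i = 0, so that `postScale` is positive.
  choose y hyθ hyS using fun i : ℕ =>
    h.exists_θhat_eq_sy2_eq hn (fun _ => -((i : ℝ) + 1)) hS
  have htend := hcons.2 y hyS fun j => by
    simp_rw [hyθ]
    exact tendsto_neg_atTop_atBot.comp
      (tendsto_atTop_add_const_right _ 1 tendsto_natCast_atTop_atTop)
  refine hδ (le_antisymm (ge_of_tendsto' htend fun i => hle _ ?_) bot_le)
  refine h.postScale_pos_of_θhat_ne_zero hs2 hnu ?_
  rw [hyθ]
  intro h0
  have := congrFun h0 ⟨0, hr₁⟩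
  simp only [Pi.zero_apply] at this
  have : (0 : ℝ) ≤ i := by positivity
  linarith

/-! ### The limit along a ray -/

/-- After division by c², the terms s_y² and νs² vanish in the limit and only the quadratic form at
v survives in `postScale`; the factor c then cancels between m and √κ. -/
theorem tendsto_postLoc (hn : r₁ + r₂ < n) (hnu : 0 ≤ M.nu) {v : Fin r₁ → ℝ} (hv : v ≠ 0)
    {y : ℝ → Fin n → ℝ} (hy : ∀ᶠ c in atTop, M.θhat (y c) = c • v)
    (hS : (fun c => M.sy2 (y c)) =o[atTop] (fun c : ℝ => c ^ 2)) :
    Tendsto (fun c => M.postLoc (y c)) atTop (𝓝 (M.limitLoc v)) := by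
  have hd := dof_pos hn hnu
  set H := v ⬝ᵥ ((M.infoθ⁻¹ + M.Omega)⁻¹ *ᵥ v) with hH
  have hH0 : 0 < H := h.posDef_inv_add_Omega.inv.quadForm_pos hv
  have hlim : Tendsto (fun c : ℝ => M.sy2 (y c) / c ^ 2 + M.nu * M.s2 / c ^ 2 + H) atTop (𝓝 H) := by
    have h1 := hS.tendsto_div_nhds_zero
    have h2 : Tendsto (fun c : ℝ => M.nu * M.s2 / c ^ 2) atTop (𝓝 0) :=
      tendsto_const_nhds.div_atTop (tendsto_pow_atTop two_ne_zero)
    simpa using (h1.add h2).add_const H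
  have hloc : M.limitLoc v = (√(H / M.dof))⁻¹ • (M.limitScale *ᵥ (M.infoθ *ᵥ v)) := by
    rw [limitLoc, ← hH]
    congr 2
    rw [Real.sqrt_div hH0.le, Real.sqrt_eq_rpow, Real.sqrt_eq_rpow, Real.rpow_neg hd.le]
    exact inv_mul_eq_div _ _
  rw [hloc]
  have hsqrt : √(H / M.dof) ≠ 0 := (Real.sqrt_pos.2 (by positivity)).ne'
  refine Tendsto.congr' ?_ ((((hlim.div_const M.dof).sqrt).inv₀ hsqrt).smul_const
    (M.limitScale *ᵥ (M.infoθ *ᵥ v)))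
  filter_upwards [hy, eventually_gt_atTop 0] with c hc hc0
  have h1 : M.postScale (y c) / M.dof
      = c ^ 2 * ((M.sy2 (y c) / c ^ 2 + M.nu * M.s2 / c ^ 2 + H) / M.dof) := by
    rw [postScale, hc, quadForm_smul, ← hH]
    field_simp
  rw [postLoc, h1, hc, Matrix.mulVec_smul, Matrix.mulVec_smul, smul_smul,
    Real.sqrt_mul (by positivity), Real.sqrt_sq hc0.le]
  congr 1
  rw [mul_inv, mul_right_comm, inv_mul_cancel₀ hc0.ne', one_mul]

theorem tendsto_posteriorProb (hn : r₁ + r₂ < n) (hs2 : 0 < M.s2) (hnu : 0 ≤ M.nu)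
    {v : Fin r₁ → ℝ} (hv : v ≠ 0) {y : ℝ → Fin n → ℝ}
    (hy : ∀ᶠ c in atTop, M.θhat (y c) = c • v)
    (hS : (fun c => M.sy2 (y c)) =o[atTop] (fun c : ℝ => c ^ 2)) :
    Tendsto (fun c => M.posteriorProb (y c) (Set.Iic 0)) atTop
      (𝓝 ((mvStudent (M.limitLoc v) M.limitScale M.dof).real (Set.Iic 0))) := by
  refine Tendsto.congr' ?_ (((continuous_mvStudent_real h.posDef_limitScale (dof_pos hn hnu)
    measurableSet_Iic).tendsto _).comp (h.tendsto_postLoc hn hnu hv hy hS))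
  filter_upwards [hy, eventually_gt_atTop 0] with c hc hc0
  refine (h.posteriorProb_eq hn hnu (h.postScale_pos_of_θhat_ne_zero hs2 hnu ?_)).symm
  rw [hc]
  exact smul_ne_zero hc0.ne' hv

end IsRegular

end OneSidedTest

/-! ### The three claims together -/

theorem mainTheorem6 (n r₁ r₂ : ℕ) (hr₁ : 0 < r₁) (hn : r₁ + r₂ < n)
    (M : OneSidedTest n r₁ r₂)
    (hX : LinearIndependent ℝ M.X.col) (hSig : M.Sig.PosDef)
    (hR : LinearIndependent ℝ M.R.row) (hD : LinearIndependent ℝ M.nuisance.row)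
    (hOmega : M.Omega.PosDef) (hs2 : 0 < M.s2) (hnu : 0 ≤ M.nu) :
    (∃ ε : ℝ, 0 < ε ∧ ∀ y : Fin n → ℝ, (0 < M.nu ∨ ∀ γ : Fin r₂ → ℝ, y ≠ M.Xγ *ᵥ γ) →
      ε ≤ M.posteriorProb y (Set.Iic 0) ∧ M.posteriorProb y (Set.Iic 0) ≤ 1 - ε) ∧
    (∀ S : ℝ, 0 ≤ S → ¬ M.InformationConsistent M.B10 S) ∧
    (∀ v : Fin r₁ → ℝ, v ≠ 0 → ∀ y : ℝ → Fin n → ℝ,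
      (∀ᶠ c in Filter.atTop, M.θhat (y c) = c • v) →
      (fun c => M.sy2 (y c)) =o[Filter.atTop] (fun c : ℝ => c ^ 2) →
      Filter.Tendsto (fun c => M.posteriorProb (y c) (Set.Iic 0)) Filter.atTop
        (nhds ((mvStudent (M.limitLoc v) M.limitScale M.dof).real (Set.Iic 0)))) := by
  have h : M.IsRegular := ⟨hX, hSig, hR, hD, hOmega⟩
  refine ⟨?_, fun S hS => h.not_informationConsistent_B10 hr₁ hn hs2 hnu hS,
    fun v hv y hy hS => h.tendsto_posteriorProb hn hs2 hnu hv hy hS⟩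
  obtain ⟨ε, hε, hle⟩ := h.exists_le_posterior hr₁ hn hs2 hnu
  refine ⟨ε, hε, fun y hy => ?_⟩
  have hκ := h.postScale_pos hs2 hnu hy
  have := isProbabilityMeasure_mvStudent h.posDef_limitScale (M.dof_pos hn hnu) (M.postLoc y)
  obtain ⟨h1, h2⟩ := hle y hκ
  -- The upper bound on the orthant is the lower bound on its complement.
  rw [probReal_compl_eq_one_sub measurableSet_Iic] at h2
  rw [h.posteriorProb_eq hn hnu hκ]
  exact ⟨h1, by linarith⟩
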